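/- \textbf{Definitions.} Functions $f:\subseteq\mathbb R^m\to\mathbb R^n$ may be partial. The \emph{juxtaposition} of $g_0,\dots,g_{n-1}:\subseteq\mathbb R^m\to\mathbb R$ is $x\mapsto(g_0(x),\dots,g_{n-1}(x))$, defined on $\bigcap_j\operatorname{dom} g_j$. The \emph{composition} $f\circ g$ is defined at those $x\in\operatorname{dom} g$ with $g(x)\in\operatorname{dom} f$. Given $f:\subseteq\mathbb R^m\to\mathbb R^n$, $g:\subseteq\mathbb R^{m+1+n}\to\mathbb R^n$ and $v\in\mathbb R^m$, let $H_v$ be the set of all $h:\subseteq\mathbb R\to\mathbb R^n$ such that $\operatorname{dom} h$ is empty or a possibly unbounded interval containing $0$, $v\in\operatorname{dom} f$ if $\operatorname{dom}h\ne\emptyset$, $(v,\tau,h(\tau))\in\operatorname{dom} g$ for every $\tau\in\operatorname{dom}h$, and for every $t\in\operatorname{dom}h$ the integral below exists and $$h(t)=f(v)+\int_0^t g(v,\tau,h(\tau))\,d\tau .$$ Call $h\in H_v$ \emph{unique} in $H_v$ if the restriction of every function in $H_v$ to $\operatorname{dom}h$ is a restriction of $h$. Let $h_v$ be the largest function unique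 in $H_v$ (it exists, as the union of all of them). \emph{Differential recursion} is the operator $\mathrm{PR}$ with $\mathrm{PR}(f,g)(v,t)=h_v(t)$, defined for those $(v,t)\in\mathbb R^{m+1}$ with $t\in\operatorname{dom}h_v$. The \emph{real primitive recursive} functions form the smallest class containing the nullary functions $0,1,-1:\mathbb R^0\to\mathbb R$ and closed under juxtaposition, composition and $\mathrm{PR}$. Let $f:\subseteq\mathbb R^m\to\mathbb R$ be real analytic with open domain. For a polynomial $P$ in $k$ variables, let $E_{P,i}(x)$ be the equation $P\bigl(f(x),\partial_i f(x),\dots,\partial_i^{k-1}f(x)\bigr)=0$. Then $f$ is \emph{differentially algebraic} if for every place $i<m$ it satisfies at least one of the following clauses, where $P$ denotes a nonzero polynomial (in any number of variables) with coefficients in $\mathbb Z$, or, in (i)--(iii), alternatively in $\mathbb R$: (i) for each open connected $J\subseteq\operatorname{dom} f$ there is $P$ with $E_{P,i}(x)$ for all $x\in J$; (ii) for each $x_0\in\operatorname{dom} f$ there are $P$ and an open $J\ni x_0$, $J\subseteq\operatorname{dom}f$, with $E_{P,i}(x)$ for all $x\in J$; (iii) for each $x_0\in\operatorname{dom} f$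 there are $P$ and an open interval $J$ containing the $i$-th coordinate of $x_0$ such that every point $x$ obtained from $x_0$ by replacing its $i$-th coordinate by an element of $J$ lies in $\operatorname{dom}f$ and satisfies $E_{P,i}(x)$; (iv) (integer coefficients only) for each $x\in\operatorname{dom} f$ there is $P$ with $E_{P,i}(x)$. (For analytic functions these clauses are equivalent.) \textbf{Theorem.} Let $\check\Gamma:\subseteq\mathbb R^2\to\mathbb R$ be the function with domain $(0,\infty)^2$ and $$\check\Gamma(R,x)=\int_{1/R}^{R}\exp\bigl((x-1)\ln t-t\bigr)\,dt .$$ Then $\check\Gamma$ is real primitive recursive and real analytic, but it is not differentially algebraic. In particular, Moore's claim that all real primitive recursive functions are differentially algebraic is false. -/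

import Mathlib

open Set MeasureTheory

namespace RealRec

noncomputable section

/-- Partial functions `f :⊆ ℝ ^ m → ℝ ^ n`. -/
abbrev PVec (m n : ℕ) : Type := (Fin m → ℝ) →. (Fin n → ℝ)

/-- The total function that agrees with `f` on its domain and is `0` elsewhere. It is only ever
evaluated on the domain of `f`, or differentiated at interior points of that domain. -/
def total {α : Type} {n : ℕ} (f : α →. (Fin n → ℝ)) (x : α) : Fin n → ℝ :=
  @Part.getOrElse _ (f x) (Classical.dec _) 0

theorem total_of_mem {α : Type} {n : ℕ} {f : α →. (Fin n → ℝ)} {x : α} {y : Fin n → ℝ}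
    (h : y ∈ f x) : total f x = y := by
  obtain ⟨hd, rfl⟩ := h
  simp [total, Part.getOrElse, hd]

theorem total_mem {α : Type} {n : ℕ} {f : α →. (Fin n → ℝ)} {x : α}
    (h : x ∈ f.Dom) : total f x ∈ f x := by
  obtain ⟨y, hy⟩ := (PFun.mem_dom f x).1 h
  rw [total_of_mem hy]; exact hy

/-! ### Juxtaposition and differential recursion -/

/-- Juxtaposition of `g 0, …, g (n - 1) :⊆ ℝ ^ m → ℝ`, defined where all of them are. -/
def juxt {m n : ℕ} (g : Fin n → PVec m 1) : PVec m n :=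
  fun x => ⟨∀ i, (g i x).Dom, fun h i => (g i x).get (h i) 0⟩

/-- The vector `(v, τ, y)`. -/
def cat {m n : ℕ} (v : Fin m → ℝ) (τ : ℝ) (y : Fin n → ℝ) : Fin (m + 1 + n) → ℝ :=
  Fin.append (Fin.snoc (α := fun _ => ℝ) v τ) y

/-- The set of all solutions `h :⊆ ℝ → ℝ ^ n` of
`h t = f v + ∫ τ in 0..t, g (v, τ, h τ)`: the domain of `h` is empty or an interval containing `0`
(then `v ∈ dom f`), the integrand is defined at every `τ ∈ dom h`, and the equation
holds, with an integral that exists, at every `t ∈ dom h`. -/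
structure IsSolution {m n : ℕ} (f : PVec m n) (g : PVec (m + 1 + n) n) (v : Fin m → ℝ)
    (h : ℝ →. (Fin n → ℝ)) : Prop where
  ordConnected : h.Dom.OrdConnected
  zero_mem : h.Dom.Nonempty → (0 : ℝ) ∈ h.Dom
  init_mem : h.Dom.Nonempty → v ∈ f.Dom
  integrand_mem : ∀ τ, ∀ y ∈ h τ, cat v τ y ∈ g.Dom
  integrable : ∀ t ∈ h.Dom,
    IntervalIntegrable (fun τ => total g (cat v τ (total h τ))) volume 0 t
  eqn : ∀ t ∈ h.Dom,
    total h t = total f v + ∫ τ in (0 : ℝ)..t, total g (cat v τ (total h τ))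

/-- `h` is unique in `H`: it lies in `H`, and the restriction of any function in `H` to the domain
of `h` is a restriction of `h`. -/
def IsUniqueIn {n : ℕ} (H : Set (ℝ →. (Fin n → ℝ))) (h : ℝ →. (Fin n → ℝ)) : Prop :=
  h ∈ H ∧ ∀ k ∈ H, ∀ t ∈ h.Dom, ∀ y ∈ k t, y ∈ h t

/-- The union of a set `K` of partial functions (used for consistent `K` only). -/
def union {n : ℕ} (K : Set (ℝ →. (Fin n → ℝ))) : ℝ →. (Fin n → ℝ) :=
  fun t => ⟨∃ y, ∃ k ∈ K, y ∈ k t, fun H => Classical.choose H⟩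

/-- The largest function that is unique among the solutions. -/
def maxUnique {m n : ℕ} (f : PVec m n) (g : PVec (m + 1 + n) n) (v : Fin m → ℝ) :
    ℝ →. (Fin n → ℝ) :=
  union {h | IsUniqueIn {k | IsSolution f g v k} h}

theorem mem_union {n : ℕ} {H : Set (ℝ →. (Fin n → ℝ))} {t : ℝ} {y : Fin n → ℝ} :
    y ∈ union {h | IsUniqueIn H h} t ↔ ∃ h, IsUniqueIn H h ∧ y ∈ h t := by
  constructor
  · rintro ⟨hd, rfl⟩
    exact Classical.choose_spec hd
  · rintro ⟨h, hh, hy⟩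
    have hd : ∃ y, ∃ k ∈ {h | IsUniqueIn H h}, y ∈ k t := ⟨y, h, hh, hy⟩
    refine ⟨hd, ?_⟩
    obtain ⟨k, hk, hc⟩ := Classical.choose_spec hd
    exact Part.mem_unique (hh.2 k hk.1 t ((PFun.mem_dom h t).2 ⟨y, hy⟩) _ hc) hy

/-- `maxUnique f g v` is itself unique among the solutions. -/
theorem isUniqueIn_maxUnique {m n : ℕ} (f : PVec m n) (g : PVec (m + 1 + n) n)
    (v : Fin m → ℝ) : IsUniqueIn {k | IsSolution f g v k} (maxUnique f g v) := by
  have key : ∀ t ∈ (maxUnique f g v).Dom, ∃ h, IsUniqueIn {k | IsSolution f g v k} h ∧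
      t ∈ h.Dom ∧ ∀ s ∈ h.Dom, s ∈ (maxUnique f g v).Dom ∧
        total (maxUnique f g v) s = total h s := by
    intro t ht
    obtain ⟨y, hy⟩ := (PFun.mem_dom _ t).1 ht
    obtain ⟨h, hh, hyt⟩ := mem_union.1 hy
    refine ⟨h, hh, (PFun.mem_dom h t).2 ⟨y, hyt⟩, fun s hs => ?_⟩
    have hm : total h s ∈ maxUnique f g v s := mem_union.2 ⟨h, hh, total_mem hs⟩
    exact ⟨(PFun.mem_dom _ s).2 ⟨_, hm⟩, total_of_mem hm⟩
  have sub : ∀ {h : ℝ →. (Fin n → ℝ)}, IsSolution f g v h → ∀ t ∈ h.Dom, uIcc 0 t ⊆ h.Dom :=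
    fun hh t ht => hh.ordConnected.uIcc_subset (hh.zero_mem ⟨t, ht⟩) ht
  refine ⟨⟨?_, ?_, ?_, ?_, ?_, ?_⟩, ?_⟩
  · refine ⟨fun a ha b hb c hc => ?_⟩
    obtain ⟨h, hh, hah, hh'⟩ := key a ha
    obtain ⟨k, hk, hbk, hk'⟩ := key b hb
    rcases le_total c 0 with hc0 | hc0
    · exact (hh' c (sub hh.1 a hah (mem_uIcc.2 (Or.inr ⟨hc.1, hc0⟩)))).1
    · exact (hk' c (sub hk.1 b hbk (mem_uIcc.2 (Or.inl ⟨hc0, hc.2⟩)))).1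
  · rintro ⟨t, ht⟩
    obtain ⟨h, hh, hth, hh'⟩ := key t ht
    exact (hh' 0 (hh.1.zero_mem ⟨t, hth⟩)).1
  · rintro ⟨t, ht⟩
    obtain ⟨h, hh, hth, hh'⟩ := key t ht
    exact hh.1.init_mem ⟨t, hth⟩
  · intro τ y hy
    obtain ⟨h, hh, hyt⟩ := mem_union.1 hy
    exact hh.1.integrand_mem τ y hyt
  · intro t ht
    obtain ⟨h, hh, hth, hh'⟩ := key t ht
    refine (hh.1.integrable t hth).congr fun s hs => ?_
    simp only [(hh' s (sub hh.1 t hth (uIoc_subset_uIcc hs))).2]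
  · intro t ht
    obtain ⟨h, hh, hth, hh'⟩ := key t ht
    rw [(hh' t hth).2, hh.1.eqn t hth]
    congr 1
    refine intervalIntegral.integral_congr fun s hs => ?_
    simp only [(hh' s (sub hh.1 t hth hs)).2]
  · intro k hk t ht y hy
    obtain ⟨z, hz⟩ := (PFun.mem_dom _ t).1 ht
    obtain ⟨h, hh, hzt⟩ := mem_union.1 hz
    exact mem_union.2 ⟨h, hh, hh.2 k hk t ((PFun.mem_dom h t).2 ⟨z, hzt⟩) y hy⟩

/-- Every function that is unique among the solutions is a restriction of `maxUnique f g v`. -/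
theorem mem_maxUnique {m n : ℕ} {f : PVec m n} {g : PVec (m + 1 + n) n} {v : Fin m → ℝ}
    {h : ℝ →. (Fin n → ℝ)} (hh : IsUniqueIn {k | IsSolution f g v k} h) {t : ℝ}
    {y : Fin n → ℝ} (hy : y ∈ h t) : y ∈ maxUnique f g v t :=
  mem_union.2 ⟨h, hh, hy⟩

/-- Differential recursion: `(v, t) ↦ h_v t`, where `h_v = maxUnique f g v`. -/
def diffRec {m n : ℕ} (f : PVec m n) (g : PVec (m + 1 + n) n) : PVec (m + 1) n :=
  fun p => maxUnique f g (Fin.init p) (p (Fin.last m))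

/-- Real primitive recursive functions: the smallest class that contains the nullary functions
`0`, `1`, `-1` and is closed under juxtaposition, composition and differential recursion. -/
inductive RealPrimRec : {m n : ℕ} → PVec m n → Prop
  | zero : RealPrimRec (m := 0) (n := 1) (PFun.lift fun _ _ => 0)
  | one : RealPrimRec (m := 0) (n := 1) (PFun.lift fun _ _ => 1)
  | neg_one : RealPrimRec (m := 0) (n := 1) (PFun.lift fun _ _ => -1)
  | juxt {m n : ℕ} (g : Fin n → PVec m 1) (hg : ∀ i, RealPrimRec (g i)) :
      RealPrimRec (juxt g)
  | comp {l m n : ℕ} (f : PVec m n) (g : PVec l m) (hf : RealPrimRec f) (hg : RealPrimRec g) :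
      RealPrimRec (PFun.comp f g)
  | diffRec {m n : ℕ} (f : PVec m n) (g : PVec (m + 1 + n) n) (hf : RealPrimRec f)
      (hg : RealPrimRec g) : RealPrimRec (diffRec f g)

/-! ### Differentially algebraic functions -/

/-- Real analytic partial functions with open domain. -/
def IsAnalytic {m n : ℕ} (f : PVec m n) : Prop :=
  IsOpen f.Dom ∧ AnalyticOnNhd ℝ (total f) f.Dom

/-- The `k`-th partial derivative of the scalar function `f` along the `i`-th place, at `x`. -/
def partialDeriv {m : ℕ} (f : PVec m 1) (i : Fin m) (k : ℕ) (x : Fin m → ℝ) : ℝ :=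
  iteratedDeriv k (fun t => total f (Function.update x i t) 0) (x i)

/-- `P (f x, D_i f x, …, D_i ^ (k - 1) f x) = 0`, where `k` is the arity of `P`. -/
def Annihilates {A : Type} [CommRing A] [Algebra A ℝ] {m k : ℕ} (P : MvPolynomial (Fin k) A)
    (f : PVec m 1) (i : Fin m) (x : Fin m → ℝ) : Prop :=
  MvPolynomial.aeval (fun j : Fin k => partialDeriv f i j x) P = 0

section Clauses

variable (A : Type) [CommRing A] [Algebra A ℝ] {m : ℕ} (f : PVec m 1) (i : Fin m)

/-- One equation on each open connected subset of the domain. -/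
def GlobalClause : Prop :=
  ∀ J : Set (Fin m → ℝ), IsOpen J → IsConnected J → J ⊆ f.Dom →
    ∃ (k : ℕ) (P : MvPolynomial (Fin k) A), P ≠ 0 ∧ ∀ x ∈ J, Annihilates P f i x

/-- One equation in a neighbourhood of each point of the domain. -/
def LocalClause : Prop :=
  ∀ x₀ ∈ f.Dom, ∃ (k : ℕ) (P : MvPolynomial (Fin k) A) (J : Set (Fin m → ℝ)),
    P ≠ 0 ∧ IsOpen J ∧ x₀ ∈ J ∧ J ⊆ f.Dom ∧ ∀ x ∈ J, Annihilates P f i x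

/-- One equation near each point of the domain on the line through it parallel to the `i`-th
axis. -/
def LineClause : Prop :=
  ∀ x₀ ∈ f.Dom, ∃ (k : ℕ) (P : MvPolynomial (Fin k) A) (J : Set ℝ),
    P ≠ 0 ∧ IsOpen J ∧ J.OrdConnected ∧ x₀ i ∈ J ∧
      ∀ t ∈ J, Function.update x₀ i t ∈ f.Dom ∧ Annihilates P f i (Function.update x₀ i t)

/-- One equation at each point of the domain. -/
def PointClause : Prop :=
  ∀ x ∈ f.Dom, ∃ (k : ℕ) (P : MvPolynomial (Fin k) A), P ≠ 0 ∧ Annihilates P f i x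

end Clauses

/-- A scalar analytic function is differentially algebraic if for every place `i` it satisfies one
of the following clauses (they are equivalent for analytic functions; over `ℝ` the pointwise
clause would be void and is not among them). -/
def DifferentiallyAlgebraic {m : ℕ} (f : PVec m 1) : Prop :=
  IsAnalytic f ∧ ∀ i : Fin m,
    GlobalClause ℤ f i ∨ LocalClause ℤ f i ∨ LineClause ℤ f i ∨ PointClause ℤ f i ∨
      GlobalClause ℝ f i ∨ LocalClause ℝ f i ∨ LineClause ℝ f i

/-! ### The truncated gamma integral -/

/-- `(R, x) ↦ ∫ t in 1/R..R, exp ((x - 1) * ln t - t)`, with domain `(0, ∞) ^ 2`. -/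
def truncGamma : PVec 2 1 :=
  fun p => ⟨0 < p 0 ∧ 0 < p 1, fun _ _ =>
    ∫ t in (1 / p 0)..(p 0), Real.exp ((p 1 - 1) * Real.log t - t)⟩

end

end RealRec

namespace RealRec

noncomputable section

/-! ### Algebraic independence from the recurrence of the gamma function -/

section Holder

open MvPolynomial Filter
open scoped MonomialOrder

/-! The substitution t = e^s with L = ln R turns the function into `truncMoment 0 L x`, and its j-th
derivative in x into `truncMoment j L x`. Only the place x is used to refute differential
algebraicity.

Each clause, restricted to a fixed L, yields a nonzero real polynomial relation among the
`truncMoment j L`, valid for all x (`HasRelation`). Its coefficients may depend wildly on L, so the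
relation itself has no limit as L → ∞. But uncountably many L share one finite support F, and for
these the determinants of the F-monomials at any |F| points x vanish. The determinants are analytic
in L, hence vanish for all L, and their limits vanish too. This is a linear dependence among
monomials in the full moments, the derivatives Γ^(j), which contradicts Hölder's theorem
(`eq_zero_of_eventually_evalAt_eq_zero`).

Hölder's theorem is proved from Γ^(j)(x+1) = xΓ^(j)(x) + jΓ^(j-1)(x). By minimality of its leading
monomial, an annihilating P is an eigenvector of the shift up to polynomial factors. Following the
shift from -M through 0 to M forces P to vanish wherever X 0 = 0, so X 0 divides P; the quotient is
a smaller annihilator because Γ has no zeros on (0, ∞).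

Primitive recursiveness comes from solving explicit differential equations. The logarithm arises
with exactly its natural domain from y' = e^(-y), and the integral is a difference of two parametric
antiderivatives. -/

/-- The lexicographic monomial order on `X 0, X 1, …` in which later variables are larger. -/
def revLex : MonomialOrder ℕ := (MonomialOrder.lex : MonomialOrder ℕᵒᵈ)

theorem revLex_single_pred_lt {j : ℕ} (hj : j ≠ 0) :
    Finsupp.single (j - 1) 1 ≺[revLex] Finsupp.single j 1 := by
  have h : (MonomialOrder.lex (σ := ℕᵒᵈ)).toSyn (Finsupp.single (OrderDual.toDual (j - 1)) 1) <
      (MonomialOrder.lex (σ := ℕᵒᵈ)).toSyn (Finsupp.single (OrderDual.toDual j) 1) := by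
    rw [MonomialOrder.lex_lt_iff, Finsupp.Lex.single_lt_iff, OrderDual.toDual_lt_toDual]
    omega
  exact h

/-- Evaluation of a polynomial in `x` and `X 0, X 1, …`. -/
def evalAt (x : ℝ) (Y : ℕ → ℝ) : MvPolynomial ℕ (Polynomial ℝ) →+* ℝ :=
  eval₂Hom (Polynomial.evalRingHom x) Y

@[simp] theorem evalAt_C (x : ℝ) (Y : ℕ → ℝ) (c : Polynomial ℝ) :
    evalAt x Y (C c) = c.eval x := by simp [evalAt]

@[simp] theorem evalAt_X (x : ℝ) (Y : ℕ → ℝ) (j : ℕ) : evalAt x Y (X j) = Y j := by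
  simp [evalAt]

/-- The substitution `x ↦ x + 1` in a polynomial. -/
def shiftCoeff : Polynomial ℝ →+* Polynomial ℝ := Polynomial.compRingHom (Polynomial.X + 1)

theorem eval_shiftCoeff (c : Polynomial ℝ) (x : ℝ) :
    (shiftCoeff c).eval x = c.eval (x + 1) := by
  simp [shiftCoeff]

theorem shiftCoeff_ne_zero {c : Polynomial ℝ} (hc : c ≠ 0) : shiftCoeff c ≠ 0 := by
  intro h
  refine hc (Polynomial.funext fun x => ?_)
  have := congrArg (Polynomial.eval (x - 1)) h
  simpa [eval_shiftCoeff] using this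

/-- The image of `X j` under the shift. -/
def shiftVar (j : ℕ) : MvPolynomial ℕ (Polynomial ℝ) :=
  C Polynomial.X * X j + (j : MvPolynomial ℕ (Polynomial ℝ)) * X (j - 1)

/-- The substitution `x ↦ x + 1`, `X j ↦ x * X j + j * X (j - 1)`. -/
def shift : MvPolynomial ℕ (Polynomial ℝ) →+* MvPolynomial ℕ (Polynomial ℝ) :=
  eval₂Hom (C.comp shiftCoeff) shiftVar

/-- The linear map `Y ↦ (x * Y j + j * Y (j - 1))_j`. -/
def shiftVec (x : ℝ) (Y : ℕ → ℝ) (j : ℕ) : ℝ := x * Y j + j * Y (j - 1)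

/-- `shift` is dual to `shiftVec`. On functions obeying the recurrence, `shift P` at x is therefore
P at x + 1, so `shift` preserves annihilators. -/
theorem evalAt_shift (x : ℝ) (Y : ℕ → ℝ) (P : MvPolynomial ℕ (Polynomial ℝ)) :
    evalAt x Y (shift P) = evalAt (x + 1) (shiftVec x Y) P := by
  have : (evalAt x Y).comp shift = evalAt (x + 1) (shiftVec x Y) := by
    refine MvPolynomial.ringHom_ext (fun c => ?_) (fun j => ?_)
    · simp [shift, eval_shiftCoeff]
    · simp [shift, shiftVar, shiftVec]
  exact DFunLike.congr_fun this P

theorem degree_shiftVar_tail_lt (j : ℕ) :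
    revLex.degree ((j : MvPolynomial ℕ (Polynomial ℝ)) * X (j - 1)) ≺[revLex]
      revLex.degree (C (Polynomial.X (R := ℝ)) * X j) := by
  have h1 : revLex.degree (C (Polynomial.X (R := ℝ)) * X j) = Finsupp.single j 1 := by
    rw [MonomialOrder.degree_mul (by simp) (X_ne_zero j)]
    simp [MonomialOrder.degree_X]
  rw [h1]
  -- For j = 0 the index j - 1 truncates to 0, but the factor j kills the tail.
  rcases eq_or_ne j 0 with rfl | hj
  · simp only [Nat.cast_zero, zero_mul, MonomialOrder.degree_zero]
    rw [map_zero, MonomialOrder.toSyn_lt_iff_ne_zero]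
    simp
  · have h2 : (j : MvPolynomial ℕ (Polynomial ℝ)) = C (j : Polynomial ℝ) := by simp
    rw [h2, MonomialOrder.degree_mul (by simpa using hj) (X_ne_zero _)]
    simpa only [MonomialOrder.degree_X, MonomialOrder.degree_C, zero_add] using
      revLex_single_pred_lt hj

theorem degree_shiftVar (j : ℕ) : revLex.degree (shiftVar j) = Finsupp.single j 1 := by
  rw [shiftVar, MonomialOrder.degree_add_of_lt (degree_shiftVar_tail_lt j),
    MonomialOrder.degree_mul (by simp) (X_ne_zero j)]
  simp [MonomialOrder.degree_X]

theorem leadingCoeff_shiftVar (j : ℕ) :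
    revLex.leadingCoeff (shiftVar j) = Polynomial.X := by
  rw [shiftVar, MonomialOrder.leadingCoeff_add_of_lt (degree_shiftVar_tail_lt j),
    MonomialOrder.leadingCoeff_mul]
  simp

theorem shiftVar_ne_zero (j : ℕ) : shiftVar j ≠ 0 := by
  intro h
  have := leadingCoeff_shiftVar j
  simp [h] at this
  exact Polynomial.X_ne_zero this.symm

theorem shift_monomial (s : ℕ →₀ ℕ) (c : Polynomial ℝ) :
    shift (monomial s c) = C (shiftCoeff c) * s.prod fun j e => shiftVar j ^ e := by
  simp [shift]

theorem degree_shift_monomial (s : ℕ →₀ ℕ) {c : Polynomial ℝ} (hc : c ≠ 0) :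
    revLex.degree (shift (monomial s c)) = s := by
  have hne : (s.prod fun j e => shiftVar j ^ e) ≠ 0 :=
    Finset.prod_ne_zero_iff.2 fun j _ => pow_ne_zero _ (shiftVar_ne_zero j)
  rw [shift_monomial, MonomialOrder.degree_mul (by simpa using shiftCoeff_ne_zero hc) hne,
    Finsupp.prod, MonomialOrder.degree_prod fun j _ => pow_ne_zero _ (shiftVar_ne_zero j)]
  simp only [MonomialOrder.degree_C, MonomialOrder.degree_pow, degree_shiftVar, zero_add]
  conv_rhs => rw [← Finsupp.sum_single s]
  simp [Finsupp.sum]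

theorem coeff_shift_monomial (s : ℕ →₀ ℕ) (c : Polynomial ℝ) :
    coeff s (shift (monomial s c)) = shiftCoeff c * Polynomial.X ^ s.degree := by
  rcases eq_or_ne c 0 with rfl | hc
  · simp
  have h1 : revLex.leadingCoeff (shift (monomial s c)) =
      shiftCoeff c * Polynomial.X ^ s.degree := by
    rw [shift_monomial, MonomialOrder.leadingCoeff_mul, MonomialOrder.leadingCoeff_C, Finsupp.prod,
      MonomialOrder.leadingCoeff_prod_of_regular]
    · simp only [MonomialOrder.leadingCoeff_pow, leadingCoeff_shiftVar]
      rw [Finset.prod_pow_eq_pow_sum, Finsupp.degree_apply]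
    · intro j _
      rw [MonomialOrder.leadingCoeff_pow, leadingCoeff_shiftVar]
      exact IsRegular.of_ne_zero (pow_ne_zero _ Polynomial.X_ne_zero)
  rw [← h1, MonomialOrder.leadingCoeff, degree_shift_monomial s hc]

/-- A monomial shifts to itself, up to a coefficient, plus smaller monomials. Hence nothing below s
contributes at s. -/
theorem coeff_shift_of_degree_le {P : MvPolynomial ℕ (Polynomial ℝ)} {s : ℕ →₀ ℕ}
    (hs : revLex.degree P ≼[revLex] s) :
    coeff s (shift P) = shiftCoeff (coeff s P) * Polynomial.X ^ s.degree := by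
  conv_lhs => rw [← support_sum_monomial_coeff P]
  rw [map_sum, coeff_sum]
  have h0 : ∀ t ∈ P.support, t ≠ s → coeff s (shift (monomial t (coeff t P))) = 0 := by
    intro t ht hts
    refine MonomialOrder.coeff_eq_zero_of_lt (m := revLex) ?_
    rw [degree_shift_monomial t (mem_support_iff.1 ht)]
    refine lt_of_le_of_ne ((MonomialOrder.le_degree ht).trans hs) fun h => hts ?_
    exact revLex.toSyn.injective h
  by_cases hsP : s ∈ P.support
  · rw [Finset.sum_eq_single_of_mem s hsP h0, coeff_shift_monomial]
  · rw [Finset.sum_eq_zero fun t ht => h0 t ht fun h => hsP (h ▸ ht), notMem_support_iff.1 hsP]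
    simp

/-! ### Iterating the shift across zero -/

/-- The product of the first `n` shifts of the variable `x`. -/
def risingProd : ℕ → Polynomial ℝ
  | 0 => 1
  | n + 1 => Polynomial.X * shiftCoeff (risingProd n)

theorem eval_neg_risingProd : ∀ {n M : ℕ}, M < n → (risingProd n).eval (-(M : ℝ)) = 0
  | 0, _, h => absurd h (Nat.not_lt_zero _)
  | n + 1, 0, _ => by simp [risingProd]
  | n + 1, M + 1, h => by
      have := eval_neg_risingProd (Nat.lt_of_succ_lt_succ h)
      simp [risingProd, eval_shiftCoeff, this]

theorem shift_iterate_eq {P : MvPolynomial ℕ (Polynomial ℝ)} {a : Polynomial ℝ} {d : ℕ}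
    (ha : a ≠ 0) (h : C a * shift P = C (Polynomial.X ^ d * shiftCoeff a) * P) (n : ℕ) :
    C a * shift^[n] P = C (risingProd n ^ d * shiftCoeff^[n] a) * P := by
  induction n with
  | zero => simp [risingProd]
  | succ n ih =>
    have hc : (C (shiftCoeff a) : MvPolynomial ℕ (Polynomial ℝ)) ≠ 0 := by
      simpa using shiftCoeff_ne_zero ha
    have hs : ∀ c, shift (C c) = C (shiftCoeff c) := fun c => by simp [shift]
    have h1 := congrArg shift ih
    rw [map_mul, map_mul, hs, hs] at h1
    refine mul_left_cancel₀ hc ?_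
    rw [Function.iterate_succ_apply', Function.iterate_succ_apply']
    calc C (shiftCoeff a) * (C a * shift (shift^[n] P))
        = C a * (C (shiftCoeff a) * shift (shift^[n] P)) := by ring
      _ = C (shiftCoeff (risingProd n ^ d * shiftCoeff^[n] a)) * (C a * shift P) := by
          rw [h1]; ring
      _ = _ := by
          rw [h]
          simp only [risingProd, map_mul, map_pow]
          ring

theorem exists_shiftVec_eq {x : ℝ} (hx : x ≠ 0) (Z : ℕ → ℝ) : ∃ Y, shiftVec x Y = Z := by
  let Y : ℕ → ℝ := fun j => Nat.rec (Z 0 / x) (fun i y => (Z (i + 1) - (i + 1 : ℕ) * y) / x) j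
  refine ⟨Y, funext fun j => ?_⟩
  cases j with
  | zero => simp [shiftVec, Y]; field_simp
  | succ i =>
    have : Y (i + 1) = (Z (i + 1) - (i + 1 : ℕ) * Y i) / x := rfl
    rw [shiftVec, this, Nat.add_sub_cancel]
    field_simp
    ring

theorem exists_shiftVec_zero_eq {Z : ℕ → ℝ} (hZ : Z 0 = 0) : ∃ Y, shiftVec 0 Y = Z := by
  refine ⟨fun j => Z (j + 1) / (j + 1 : ℕ), funext fun j => ?_⟩
  cases j with
  | zero => simp [shiftVec, hZ]
  | succ i =>
    simp only [shiftVec, Nat.add_sub_cancel]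
    field_simp
    simp

/-- The iterated shift moves the base point from -M to -M + n by successive maps `shiftVec`. These
are onto except at base point 0, where the image is Z 0 = 0. Later steps multiply coordinate 0 by a
nonzero number, so this is the only constraint. -/
theorem exists_evalAt_shift_iterate (M n : ℕ) (Z : ℕ → ℝ) (hZ : M < n → Z 0 = 0) :
    ∃ Y, ∀ Q, evalAt (-(M : ℝ)) Y (shift^[n] Q) = evalAt (-(M : ℝ) + n) Z Q := by
  induction n generalizing Z with
  | zero => exact ⟨Z, fun Q => by simp⟩
  | succ n ih =>
    have key : ∃ Z', shiftVec (-(M : ℝ) + n) Z' = Z ∧ (M < n → Z' 0 = 0) := by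
      rcases eq_or_ne n M with rfl | hn
      · obtain ⟨Z', h⟩ := exists_shiftVec_zero_eq (hZ (Nat.lt_succ_self _))
        exact ⟨Z', by simpa using h, fun h => absurd h (lt_irrefl _)⟩
      · have hx : -(M : ℝ) + n ≠ 0 := by
          intro h
          have : (n : ℝ) = M := by linarith
          exact hn (by exact_mod_cast this)
        obtain ⟨Z', h⟩ := exists_shiftVec_eq hx Z
        refine ⟨Z', h, fun hMn => ?_⟩
        have h0 := congrFun h 0
        rw [hZ (by omega)] at h0
        simpa [shiftVec, hx] using h0
    obtain ⟨Z', h1, h2⟩ := key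
    obtain ⟨Y, hY⟩ := ih Z' h2
    refine ⟨Y, fun Q => ?_⟩
    rw [Function.iterate_succ_apply, hY, evalAt_shift, h1]
    push_cast
    rw [add_assoc]

theorem X_dvd_sub_aeval_update_zero (P : MvPolynomial ℕ (Polynomial ℝ)) :
    X 0 ∣ P - aeval (Function.update (X : ℕ → MvPolynomial ℕ (Polynomial ℝ)) 0 0) P := by
  induction P using MvPolynomial.induction_on with
  | C c => simp
  | add p q hp hq =>
    rw [map_add, add_sub_add_comm]
    exact dvd_add hp hq
  | mul_X p n hp =>
    rw [map_mul, aeval_X]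
    rcases eq_or_ne n 0 with rfl | hn
    · simp
    · rw [Function.update_of_ne hn, ← sub_mul]
      exact dvd_mul_of_dvd_left hp _

/-- Setting X 0 = 0 leaves a polynomial whose coefficients in ℝ[x] vanish on the infinite set S,
hence are zero. -/
theorem X_zero_dvd_of_evalAt_eq_zero {P : MvPolynomial ℕ (Polynomial ℝ)} {S : Set ℝ}
    (hS : S.Infinite) (h : ∀ x ∈ S, ∀ Z : ℕ → ℝ, Z 0 = 0 → evalAt x Z P = 0) : X 0 ∣ P := by
  have hd := X_dvd_sub_aeval_update_zero P
  set Q := aeval (Function.update (X : ℕ → MvPolynomial ℕ (Polynomial ℝ)) 0 0) P with hQ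
  have hev : ∀ x Z, evalAt x Z Q = evalAt x (Function.update Z 0 0) P := by
    intro x Z
    have : (evalAt x Z).comp
        (aeval (Function.update (X : ℕ → MvPolynomial ℕ (Polynomial ℝ)) 0 0)).toRingHom =
        evalAt x (Function.update Z 0 0) := by
      refine MvPolynomial.ringHom_ext (fun c => ?_) (fun j => ?_)
      · simp
      · rcases eq_or_ne j 0 with rfl | hj
        · simp
        · simp [Function.update_of_ne hj]
    exact DFunLike.congr_fun this P
  have hmap : ∀ x ∈ S, map (Polynomial.evalRingHom x) Q = 0 := by
    intro x hx
    refine MvPolynomial.funext fun Z => ?_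
    rw [eval_map, map_zero]
    exact (hev x Z).trans (h x hx _ (by simp))
  have hQ0 : Q = 0 := by
    refine MvPolynomial.ext _ _ fun s => ?_
    rw [coeff_zero]
    refine Polynomial.eq_zero_of_infinite_isRoot _ (hS.mono fun x hx => ?_)
    have := congrArg (coeff s) (hmap x hx)
    simpa [coeff_map] using this
  rwa [hQ0, sub_zero] at hd

/-- Functions with `G j (x + 1) = x * G j x + j * G (j - 1) x` are algebraically independent over
`ℝ[x]`, unless `G 0` has zeros. -/
theorem eq_zero_of_eventually_evalAt_eq_zero {G : ℕ → ℝ → ℝ}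
    (hG : ∀ j x, 0 < x → G j (x + 1) = x * G j x + j * G (j - 1) x)
    (hG0 : ∀ x, 0 < x → G 0 x ≠ 0) (P : MvPolynomial ℕ (Polynomial ℝ))
    (hP : ∀ᶠ x in atTop, evalAt x (fun j => G j x) P = 0) : P = 0 := by
  induction hs : revLex.toSyn (revLex.degree P) using WellFoundedLT.induction generalizing P with
  | ind s ih =>
  subst hs
  by_contra hne
  set a := revLex.leadingCoeff P with ha
  have ha0 : a ≠ 0 := MonomialOrder.leadingCoeff_ne_zero_iff.2 hne
  set d := (revLex.degree P).degree with hd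
  have hroots : ∀ c : Polynomial ℝ, c ≠ 0 → {x : ℝ | c.eval x = 0}.Finite := by
    intro c hc
    exact (c.roots.toFinset.finite_toSet).subset fun x hx => by simpa [hc] using hx
  -- The leading terms cancel in the difference, which still annihilates G, so the induction
  -- hypothesis makes it zero.
  have hrel : C a * shift P = C (Polynomial.X ^ d * shiftCoeff a) * P := by
    rw [← sub_eq_zero]
    set Q := C a * shift P - C (Polynomial.X ^ d * shiftCoeff a) * P with hQ
    by_contra hQ0
    refine hQ0 (ih _ ?_ Q ?_ rfl)
    · by_contra hle
      rw [not_lt] at hle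
      refine MonomialOrder.coeff_degree_ne_zero_iff (m := revLex).2 hQ0 ?_
      rw [hQ, coeff_sub, coeff_C_mul, coeff_C_mul, coeff_shift_of_degree_le hle, ← hQ]
      rcases hle.eq_or_lt with heq | hlt
      · rw [← revLex.toSyn.injective heq]
        change a * (shiftCoeff a * _) - _ * a = 0
        ring
      · rw [MonomialOrder.coeff_eq_zero_of_lt hlt]
        simp
    · filter_upwards [hP, tendsto_atTop_add_const_right atTop (1 : ℝ) tendsto_id hP,
        eventually_gt_atTop 0] with x h1 h2 h3
      have h4 : shiftVec x (fun j => G j x) = fun j => G j (x + 1) :=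
        funext fun j => (hG j x h3).symm
      rw [hQ, map_sub, map_mul, map_mul, evalAt_shift, h4, h1]
      have h5 : evalAt (x + 1) (fun j => G j (x + 1)) P = 0 := h2
      rw [h5]
      simp
  rcases eq_or_ne (revLex.degree P) 0 with h0 | h0
  · rw [MonomialOrder.eq_C_of_degree_eq_zero h0] at hP
    simp only [evalAt_C] at hP
    obtain ⟨x0, hx0⟩ := eventually_atTop.1 hP
    exact ((Set.Ici_infinite x0).mono hx0) (hroots _ ha0)
  have hd0 : d ≠ 0 := fun h => h0 ((Finsupp.degree_eq_zero_iff _).1 h)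
  have hX : X 0 ∣ P := by
    refine X_zero_dvd_of_evalAt_eq_zero
      (S := (fun M : ℕ => (M : ℝ)) '' {M | 0 < M ∧ a.eval (-(M : ℝ)) ≠ 0}) ?_ ?_
    · refine Set.Infinite.image (Nat.cast_injective.injOn) ?_
      have hf : {M : ℕ | a.eval (-(M : ℝ)) = 0}.Finite :=
        (hroots a ha0).preimage (f := fun M : ℕ => -(M : ℝ))
          (fun _ _ _ _ h => by simpa using h)
      refine ((Set.Ioi_infinite 0).sdiff hf).mono fun M hM => ⟨hM.1, hM.2⟩
    · rintro _ ⟨M, ⟨hM, haM⟩, rfl⟩ Z hZ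
      -- With 2M > M steps the path crosses 0, so `risingProd` vanishes at -M and the right side of
      -- the iterated relation dies; it ends at M.
      obtain ⟨Y, hY⟩ := exists_evalAt_shift_iterate M (2 * M) Z fun _ => hZ
      have h1 := congrArg (evalAt (-(M : ℝ)) Y) (shift_iterate_eq ha0 hrel (2 * M))
      rw [map_mul, map_mul, hY, evalAt_C, evalAt_C, Polynomial.eval_mul, Polynomial.eval_pow,
        eval_neg_risingProd (by omega), zero_pow hd0, zero_mul, zero_mul] at h1
      have h2 : -(M : ℝ) + (2 * M : ℕ) = M := by push_cast; ring
      rw [h2] at h1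
      exact (mul_eq_zero.1 h1).resolve_left haM
  obtain ⟨Q, rfl⟩ := hX
  have hQ0 : Q ≠ 0 := right_ne_zero_of_mul hne
  refine hQ0 (ih _ ?_ Q ?_ rfl)
  · rw [MonomialOrder.degree_mul (X_ne_zero 0) hQ0, map_add]
    refine lt_add_of_pos_left _ ?_
    rw [MonomialOrder.degree_X, MonomialOrder.toSyn_lt_iff_ne_zero]
    simp
  · filter_upwards [hP, eventually_gt_atTop 0] with x h1 h2
    rw [map_mul, evalAt_X] at h1
    exact (mul_eq_zero.1 h1).resolve_left (hG0 x h2)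

end Holder

/-! ### Truncated moments -/

section Moments

open Filter Topology

/-- `∫ s in -L..L, s ^ j * exp (x * s - exp s)`. -/
def truncMoment (j : ℕ) (L x : ℝ) : ℝ := ∫ s in (-L)..L, s ^ j * Real.exp (x * s - Real.exp s)

/-! ### Analyticity through the Banach algebra C[-1, 1] -/

/-- The Banach algebra of continuous functions on `[-1, 1]`. -/
abbrev UnitFun : Type := C(Icc (-1 : ℝ) 1, ℝ)

/-- The inclusion of `[-1, 1]` into `ℝ`. -/
def unitId : UnitFun := ⟨Subtype.val, continuous_subtype_val⟩

/-- Integration over `[-1, 1]`. -/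
def unitIntegral : UnitFun →L[ℝ] ℝ :=
  LinearMap.mkContinuous
    { toFun := fun f => ∫ t in (-1 : ℝ)..1, f (projIcc (-1) 1 (by norm_num) t)
      map_add' := fun f g => by
        refine intervalIntegral.integral_add ?_ ?_ <;>
          exact Continuous.intervalIntegrable (by fun_prop) _ _
      map_smul' := fun c f => by
        simp [intervalIntegral.integral_const_mul] }
    2 fun f => by
      have := intervalIntegral.norm_integral_le_of_norm_le_const (a := (-1 : ℝ)) (b := 1)
        (f := fun t => f (projIcc (-1) 1 (by norm_num) t)) (C := ‖f‖)
        fun t _ => f.norm_coe_le_norm _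
      norm_num at this
      simpa [mul_comm] using this

theorem unitIntegral_apply (f : UnitFun) {F : ℝ → ℝ} (h : ∀ t, f t = F t) :
    unitIntegral f = ∫ t in (-1 : ℝ)..1, F t := by
  change ∫ t in (-1 : ℝ)..1, f (projIcc (-1) 1 (by norm_num) t) = _
  refine intervalIntegral.integral_congr fun t ht => ?_
  rw [uIcc_of_le (by norm_num)] at ht
  simp only [h, projIcc_of_mem _ ht]

theorem exp_unitFun_apply (f : UnitFun) (t : Icc (-1 : ℝ) 1) :
    (NormedSpace.exp f) t = Real.exp (f t) := by
  let _ : NormedAlgebra ℚ UnitFun := NormedAlgebra.restrictScalars ℚ ℝ UnitFun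
  have h := NormedSpace.map_exp (ContinuousMap.evalAlgHom ℝ ℝ t)
    (continuous_eval_const t) f
  rw [Real.exp_eq_exp_ℝ]
  exact h

/-- The integrand of `truncMoment`, rescaled to `[-1, 1]`. -/
def momentFun (j : ℕ) (L x : ℝ) : UnitFun :=
  (L • unitId) ^ j * NormedSpace.exp (x • (L • unitId)) *
    NormedSpace.exp (-NormedSpace.exp (L • unitId))

/-- Rescaling by s = Lt fixes the interval. Both parameters then enter through exponentials in a
Banach algebra, and a continuous linear functional transports derivatives and analyticity to the
integral. -/
theorem truncMoment_eq (j : ℕ) (L x : ℝ) :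
    truncMoment j L x = L * unitIntegral (momentFun j L x) := by
  rw [unitIntegral_apply (momentFun j L x)
    (F := fun t => (L * t) ^ j * Real.exp (x * (L * t) - Real.exp (L * t))),
    intervalIntegral.mul_integral_comp_mul_left
      (f := fun s => s ^ j * Real.exp (x * s - Real.exp s)), truncMoment]
  · simp
  · intro t
    simp only [momentFun, ContinuousMap.mul_apply, ContinuousMap.pow_apply, exp_unitFun_apply,
      ContinuousMap.neg_apply, ContinuousMap.smul_apply, smul_eq_mul]
    rw [sub_eq_add_neg, Real.exp_add, mul_assoc]
    rfl

theorem hasDerivAt_truncMoment (j : ℕ) (L x : ℝ) :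
    HasDerivAt (truncMoment j L) (truncMoment (j + 1) L x) x := by
  have h1 := (((hasDerivAt_exp_smul_const (𝕂 := ℝ) (L • unitId) x).const_mul
    ((L • unitId) ^ j)).mul_const (NormedSpace.exp (-NormedSpace.exp (L • unitId))))
  have h2 := (unitIntegral.hasFDerivAt.comp_hasDerivAt x h1).const_mul L
  have h3 : truncMoment j L = fun y => L * unitIntegral (momentFun j L y) :=
    funext fun y => truncMoment_eq j L y
  rw [h3, truncMoment_eq]
  refine h2.congr_deriv ?_
  congr 2
  rw [momentFun]
  ring

theorem iteratedDeriv_truncMoment (j : ℕ) (L : ℝ) :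
    iteratedDeriv j (truncMoment 0 L) = truncMoment j L := by
  induction j with
  | zero => simp
  | succ j ih =>
    rw [iteratedDeriv_succ, ih]
    exact funext fun x => (hasDerivAt_truncMoment j L x).deriv

theorem analyticAt_momentFun (j : ℕ) (p : ℝ × ℝ) :
    AnalyticAt ℝ (fun p : ℝ × ℝ => momentFun j p.1 p.2) p := by
  have h1 : AnalyticAt ℝ (fun p : ℝ × ℝ => p.1 • unitId) p :=
    analyticAt_fst.smul analyticAt_const
  have h2 : AnalyticAt ℝ (fun p : ℝ × ℝ => p.2 • p.1 • unitId) p := analyticAt_snd.smul h1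
  have he : ∀ f : UnitFun, AnalyticAt ℝ (NormedSpace.exp : UnitFun → UnitFun) f :=
    fun f => NormedSpace.exp_analytic f
  exact ((h1.pow j).mul ((he _).fun_comp h2)).mul ((he _).fun_comp ((he _).fun_comp h1).neg)

theorem analyticAt_truncMoment (j : ℕ) (p : ℝ × ℝ) :
    AnalyticAt ℝ (fun p : ℝ × ℝ => truncMoment j p.1 p.2) p := by
  simp only [truncMoment_eq]
  exact analyticAt_fst.mul ((unitIntegral.analyticAt _).fun_comp (analyticAt_momentFun j p))

theorem analyticAt_truncMoment_right (j : ℕ) (L x : ℝ) :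
    AnalyticAt ℝ (fun x => truncMoment j L x) x :=
  (analyticAt_truncMoment j (L, x)).fun_comp (g := fun p : ℝ × ℝ => truncMoment j p.1 p.2)
    (f := fun x => (L, x)) (analyticAt_const.prod analyticAt_id)

theorem analyticAt_truncMoment_left (j : ℕ) (L x : ℝ) :
    AnalyticAt ℝ (fun L => truncMoment j L x) L :=
  (analyticAt_truncMoment j (L, x)).fun_comp (g := fun p : ℝ × ℝ => truncMoment j p.1 p.2)
    (f := fun L => (L, x)) (analyticAt_id.prod analyticAt_const)

theorem integral_exp_log_eq_truncMoment {R : ℝ} (hR : 0 < R) (x : ℝ) :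
    ∫ t in (1 / R)..R, Real.exp ((x - 1) * Real.log t - t) = truncMoment 0 (Real.log R) x := by
  have h := intervalIntegral.integral_comp_mul_deriv' (a := -Real.log R) (b := Real.log R)
    (f := Real.exp) (f' := Real.exp) (g := fun t => Real.exp ((x - 1) * Real.log t - t))
    (fun s _ => Real.hasDerivAt_exp s) Real.continuous_exp.continuousOn (by
      refine Real.continuous_exp.comp_continuousOn
        (((continuousOn_const.mul (Real.continuousOn_log.mono ?_))).sub continuousOn_id)
      rintro _ ⟨s, _, rfl⟩
      exact (Real.exp_pos s).ne')
  rw [Real.exp_neg, Real.exp_log hR, ← one_div] at h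
  rw [← h, truncMoment]
  refine intervalIntegral.integral_congr fun s _ => ?_
  simp only [Function.comp, Real.log_exp, pow_zero, one_mul]
  rw [← Real.exp_add]
  congr 1
  ring

theorem truncGamma_dom : truncGamma.Dom = {p | 0 < p 0 ∧ 0 < p 1} := rfl

theorem total_truncGamma {p : Fin 2 → ℝ} (hp : p ∈ truncGamma.Dom) :
    total truncGamma p = fun _ => truncMoment 0 (Real.log (p 0)) (p 1) :=
  total_of_mem ⟨hp, funext fun _ => integral_exp_log_eq_truncMoment hp.1 _⟩

theorem isOpen_dom_truncGamma : IsOpen truncGamma.Dom :=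
  (isOpen_lt continuous_const (continuous_apply 0)).inter
    (isOpen_lt continuous_const (continuous_apply 1))

theorem isAnalytic_truncGamma : IsAnalytic truncGamma := by
  refine ⟨isOpen_dom_truncGamma, fun p hp => ?_⟩
  have h0 : AnalyticAt ℝ (fun q : Fin 2 → ℝ => q 0) p :=
    (ContinuousLinearMap.proj (R := ℝ) (φ := fun _ : Fin 2 => ℝ) 0).analyticAt p
  have h1 : AnalyticAt ℝ (fun q : Fin 2 → ℝ => q 1) p :=
    (ContinuousLinearMap.proj (R := ℝ) (φ := fun _ : Fin 2 => ℝ) 1).analyticAt p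
  have hl : AnalyticAt ℝ (fun q : Fin 2 → ℝ => Real.log (q 0)) p :=
    (analyticAt_id.log hp.1 : AnalyticAt ℝ (fun r => Real.log r) (p 0)).fun_comp
      (f := fun q : Fin 2 → ℝ => q 0) h0
  have h : AnalyticAt ℝ (fun q : Fin 2 → ℝ => fun _ : Fin 1 =>
      truncMoment 0 (Real.log (q 0)) (q 1)) p :=
    AnalyticAt.pi fun _ => (analyticAt_truncMoment 0 (Real.log (p 0), p 1)).fun_comp
      (g := fun p : ℝ × ℝ => truncMoment 0 p.1 p.2)
      (f := fun q : Fin 2 → ℝ => (Real.log (q 0), q 1)) (hl.prod h1)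
  refine h.congr ?_
  filter_upwards [isOpen_dom_truncGamma.mem_nhds hp] with q hq
  exact (total_truncGamma hq).symm

theorem partialDeriv_truncGamma {p : Fin 2 → ℝ} (hp : p ∈ truncGamma.Dom) (j : ℕ) :
    partialDeriv truncGamma 1 j p = truncMoment j (Real.log (p 0)) (p 1) := by
  have h : (fun t => total truncGamma (Function.update p 1 t) 0) =ᶠ[𝓝 (p 1)]
      truncMoment 0 (Real.log (p 0)) := by
    filter_upwards [lt_mem_nhds hp.2] with t ht
    have hm : Function.update p 1 t ∈ truncGamma.Dom := by
      rw [truncGamma_dom]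
      simpa using ⟨hp.1, ht⟩
    rw [total_truncGamma hm]
    simp
  rw [partialDeriv, h.iteratedDeriv_eq j, iteratedDeriv_truncMoment]

/-! ### Full moments and their recurrence -/

/-- `∫ s, s ^ j * exp (x * s - exp s)`, the `j`-th derivative of the gamma function. -/
def moment (j : ℕ) (x : ℝ) : ℝ := ∫ s, s ^ j * Real.exp (x * s - Real.exp s)

theorem tendsto_pow_mul_exp_neg_mul_atTop (j : ℕ) {b : ℝ} (hb : 0 < b) :
    Tendsto (fun s : ℝ => s ^ j * Real.exp (-b * s)) atTop (𝓝 0) := by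
  have := tendsto_rpow_mul_exp_neg_mul_atTop_nhds_zero (j : ℝ) b hb
  simpa using this

theorem integrableOn_moment_Ioi (j : ℕ) (x : ℝ) :
    IntegrableOn (fun s => s ^ j * Real.exp (x * s - Real.exp s)) (Ioi 0) := by
  refine integrable_of_isBigO_exp_neg one_pos (by fun_prop) ?_
  have h1 : Tendsto (fun s : ℝ => s ^ j * Real.exp (-1 * s)) atTop (𝓝 0) :=
    tendsto_pow_mul_exp_neg_mul_atTop j one_pos
  have h2 : (fun s : ℝ => Real.exp (x * s - Real.exp s)) =O[atTop]
      fun s => Real.exp (-2 * s) := by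
    refine Asymptotics.IsBigO.of_bound 1 ?_
    -- From s ≥ 2|x + 2| one gets e^s ≥ s²/2 ≥ (x + 2)s. Of the resulting bound e^(-2s), one factor
    -- e^(-s) absorbs s^j.
    filter_upwards [eventually_ge_atTop (2 * |x + 2|), eventually_ge_atTop 0] with s hs hs0
    rw [one_mul, Real.norm_of_nonneg (Real.exp_pos _).le, Real.norm_of_nonneg (Real.exp_pos _).le,
      Real.exp_le_exp]
    have h3 := Real.quadratic_le_exp_of_nonneg hs0
    have h4 := le_abs_self (x + 2)
    nlinarith
  have h3 := (Asymptotics.isBigO_refl (fun s : ℝ => s ^ j) atTop).mul h2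
  refine h3.trans ?_
  have h4 := (h1.isBigO_one ℝ).mul
    (Asymptotics.isBigO_refl (fun s : ℝ => Real.exp (-1 * s)) atTop)
  refine h4.congr (fun s => ?_) fun s => one_mul _
  rw [mul_assoc, ← Real.exp_add]
  congr 2
  ring

/-- After reflection the integrand is at most s^j e^(-xs) in absolute value for s ≥ 0; half of the
exponential absorbs the power. -/
theorem integrableOn_moment_Iic (j : ℕ) {x : ℝ} (hx : 0 < x) :
    IntegrableOn (fun s => s ^ j * Real.exp (x * s - Real.exp s)) (Iic 0) := by
  rw [← (Measure.measurePreserving_neg (volume : Measure ℝ)).integrableOn_comp_preimage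
    (MeasurableEquiv.neg ℝ).measurableEmbedding]
  have hpre : (Neg.neg ⁻¹' Iic (0 : ℝ)) = Ici 0 := by ext s; simp
  rw [hpre, integrableOn_Ici_iff_integrableOn_Ioi]
  refine integrable_of_isBigO_exp_neg (half_pos hx) (by fun_prop) ?_
  have h1 : Tendsto (fun s : ℝ => s ^ j * Real.exp (-(x / 2) * s)) atTop (𝓝 0) :=
    tendsto_pow_mul_exp_neg_mul_atTop j (half_pos hx)
  refine (Asymptotics.IsBigO.of_bound 1 ?_).trans (((h1.isBigO_one ℝ).mul
    (Asymptotics.isBigO_refl (fun s : ℝ => Real.exp (-(x / 2) * s)) atTop)).congr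
      (fun s => rfl) fun s => one_mul _)
  filter_upwards with s
  rw [one_mul, Function.comp, norm_mul, norm_mul, norm_mul, norm_pow, norm_pow, norm_neg,
    mul_assoc]
  refine mul_le_mul_of_nonneg_left ?_ (by positivity)
  rw [← norm_mul, ← Real.exp_add, Real.norm_of_nonneg (Real.exp_pos _).le,
    Real.norm_of_nonneg (Real.exp_pos _).le, Real.exp_le_exp]
  have := Real.exp_pos (-s)
  linarith

theorem integrable_moment (j : ℕ) {x : ℝ} (hx : 0 < x) :
    Integrable (fun s => s ^ j * Real.exp (x * s - Real.exp s)) := by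
  rw [← integrableOn_univ, ← Iic_union_Ioi (a := (0 : ℝ))]
  exact (integrableOn_moment_Iic j hx).union (integrableOn_moment_Ioi j x)

theorem tendsto_truncMoment (j : ℕ) {x : ℝ} (hx : 0 < x) :
    Tendsto (fun L => truncMoment j L x) atTop (𝓝 (moment j x)) :=
  intervalIntegral_tendsto_integral (integrable_moment j hx) tendsto_neg_atTop_atBot tendsto_id

/-- Integration by parts: the derivative of s^j exp(xs - e^s) integrates to zero over ℝ. -/
theorem moment_add_one (j : ℕ) (x : ℝ) (hx : 0 < x) :
    moment j (x + 1) = x * moment j x + j * moment (j - 1) x := by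
  have hd : ∀ s : ℝ, HasDerivAt (fun s => s ^ j * Real.exp (x * s - Real.exp s))
      (x * (s ^ j * Real.exp (x * s - Real.exp s)) +
        j * (s ^ (j - 1) * Real.exp (x * s - Real.exp s)) -
        s ^ j * Real.exp ((x + 1) * s - Real.exp s)) s := by
    intro s
    have h := (hasDerivAt_pow j s).mul
      (((hasDerivAt_id s).const_mul x).sub (Real.hasDerivAt_exp s)).exp
    refine h.congr_deriv ?_
    have : Real.exp ((x + 1) * s - Real.exp s) = Real.exp (x * s - Real.exp s) * Real.exp s := by
      rw [← Real.exp_add]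
      congr 1
      ring
    rw [this]
    simp only [id, Pi.sub_apply]
    ring
  have i1 := (integrable_moment j hx).const_mul x
  have i2 := (integrable_moment (j - 1) hx).const_mul (j : ℝ)
  have i3 := integrable_moment j (add_pos hx one_pos)
  have h := integral_eq_zero_of_hasDerivAt_of_integrable hd ((i1.add i2).sub i3)
    (integrable_moment j hx)
  rw [integral_sub (by exact i1.add i2) i3, integral_add i1 i2, integral_const_mul,
    integral_const_mul] at h
  exact (sub_eq_zero.1 h).symm

theorem moment_zero_pos (x : ℝ) (hx : 0 < x) : 0 < moment 0 x := by
  have hi := integrable_moment 0 hx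
  have hp : ∀ s : ℝ, 0 < s ^ 0 * Real.exp (x * s - Real.exp s) := fun s => by positivity
  rw [moment, integral_pos_iff_support_of_nonneg (fun s => (hp s).le) hi]
  have : Function.support (fun s : ℝ => s ^ 0 * Real.exp (x * s - Real.exp s)) = univ :=
    eq_univ_of_forall fun s => (hp s).ne'
  rw [this]
  simp

end Moments

/-! ### The truncated gamma integral is not differentially algebraic -/

section NotDiffAlg

open Filter Topology

/-- If the vectors v x spanned, a basis chosen among them would give a nonzero determinant.
Otherwise they lie in a hyperplane, whose equation is c. -/
theorem exists_ne_zero_forall_sum_eq_zero {X ι : Type} [Fintype ι] [DecidableEq ι]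
    (v : X → ι → ℝ) (h : ∀ x : ι → X, (Matrix.of fun i j => v (x i) j).det = 0) :
    ∃ c : ι → ℝ, c ≠ 0 ∧ ∀ x, ∑ j, c j * v x j = 0 := by
  by_cases htop : Submodule.span ℝ (range v) = ⊤
  · exfalso
    obtain ⟨b, hb, hspan, hli⟩ := exists_linearIndependent ℝ (range v)
    have hbasis := Module.Basis.mk hli (by rw [Subtype.range_coe, hspan, htop])
    have : Fintype b := FiniteDimensional.fintypeBasisIndex hbasis
    have hcard : Fintype.card ι = Fintype.card b := by
      rw [← Module.finrank_eq_card_basis hbasis, Module.finrank_fintype_fun_eq_card]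
    let e : ι ≃ b := Fintype.equivOfCardEq hcard
    choose x hx using fun i => hb (e i).2
    have hli' : LinearIndependent ℝ (Matrix.of fun i j => v (x i) j).row := by
      have : (Matrix.of fun i j => v (x i) j).row = fun i => ((e i : b) : ι → ℝ) :=
        funext fun i => hx i
      rw [this]
      exact hli.comp e e.injective
    exact ((Matrix.isUnit_iff_isUnit_det _).1
      (Matrix.linearIndependent_rows_iff_isUnit.1 hli')).ne_zero (h x)
  · obtain ⟨f, hf, hle⟩ := Submodule.exists_le_ker_of_lt_top _ (lt_top_iff_ne_top.2 htop)
    have hfv : ∀ w : ι → ℝ, f w = ∑ j, f (Pi.single j 1) * w j := fun w => by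
      rw [LinearMap.pi_apply_eq_sum_univ f w]
      refine Finset.sum_congr rfl fun j _ => ?_
      rw [smul_eq_mul, mul_comm]
      congr 2
      ext i
      simp [Pi.single_apply, eq_comm]
    refine ⟨fun j => f (Pi.single j 1), fun h0 => hf (LinearMap.ext fun w => ?_), fun x => ?_⟩
    · rw [hfv]
      simp [fun j => congrFun h0 j]
    · rw [← hfv]
      exact hle (Submodule.subset_span ⟨x, rfl⟩)

theorem exists_accPt_of_not_countable {S : Set ℝ} (hS : ¬ S.Countable) : ∃ z, AccPt z (𝓟 S) := by
  have : ∃ n : ℕ, (S ∩ Icc (-n : ℝ) n).Infinite := by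
    by_contra! hfin
    refine hS ((countable_iUnion fun n => (hfin n).countable).mono fun x hx => ?_)
    obtain ⟨n, hn⟩ := exists_nat_ge |x|
    exact mem_iUnion.2 ⟨n, hx, abs_le.1 hn⟩
  obtain ⟨n, hn⟩ := this
  obtain ⟨z, -, hz⟩ := hn.exists_accPt_of_subset_isCompact isCompact_Icc inter_subset_right
  exact ⟨z, hz.mono (principal_mono.2 inter_subset_left)⟩

theorem eq_zero_of_analytic_of_not_countable {f : ℝ → ℝ} (hf : ∀ x, AnalyticAt ℝ f x) {S : Set ℝ}
    (hS : ¬ S.Countable) (h : ∀ x ∈ S, f x = 0) (x : ℝ) : f x = 0 := by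
  obtain ⟨z, hz⟩ := exists_accPt_of_not_countable hS
  have hfr := (accPt_iff_frequently_nhdsNE.1 hz).mono h
  exact AnalyticOnNhd.eqOn_zero_of_preconnected_of_frequently_eq_zero (fun x _ => hf x)
    isPreconnected_univ (mem_univ z) hfr (mem_univ x)

theorem not_countable_of_isOpen {S : Set ℝ} (hS : IsOpen S) (hne : S.Nonempty) :
    ¬ S.Countable := fun h =>
  (hS.measure_pos volume hne).ne' (h.measure_zero volume)

theorem eval_truncMoment_eq_zero {L : ℝ} {Q : MvPolynomial ℕ ℝ} {S : Set ℝ} (hS : ¬ S.Countable)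
    (h : ∀ x ∈ S, Q.eval (fun j => truncMoment j L x) = 0) (x : ℝ) :
    Q.eval (fun j => truncMoment j L x) = 0 := by
  refine eq_zero_of_analytic_of_not_countable (f := fun x => Q.eval fun j => truncMoment j L x)
    (fun x => ?_) hS h x
  simp only [MvPolynomial.eval_eq]
  refine Finset.analyticAt_fun_sum _ fun s _ => analyticAt_const.mul ?_
  exact Finset.analyticAt_fun_prod _ fun j _ => (analyticAt_truncMoment_right j L x).pow _

/-! ### From the clauses to polynomial relations -/

/-- The functions `truncMoment j L` satisfy a polynomial relation. -/
def HasRelation (L : ℝ) : Prop :=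
  ∃ Q : MvPolynomial ℕ ℝ, Q ≠ 0 ∧ ∀ x, Q.eval (fun j => truncMoment j L x) = 0

/-- The point of the domain of `truncGamma` with coordinates `exp L` and `t`. -/
def gammaPoint (L t : ℝ) : Fin 2 → ℝ := ![Real.exp L, t]

theorem gammaPoint_mem_dom {L t : ℝ} : gammaPoint L t ∈ truncGamma.Dom ↔ 0 < t := by
  rw [truncGamma_dom]
  simp [gammaPoint, Real.exp_pos]

theorem update_gammaPoint (L s t : ℝ) :
    Function.update (gammaPoint L s) 1 t = gammaPoint L t := by
  ext i
  fin_cases i <;> simp [gammaPoint]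

theorem continuous_gammaPoint (L : ℝ) : Continuous (gammaPoint L) := by
  unfold gammaPoint
  fun_prop

theorem hasRelation_of_annihilates {A : Type} [CommRing A] [Algebra A ℝ]
    (hA : Function.Injective (algebraMap A ℝ)) {L : ℝ} {k : ℕ} {P : MvPolynomial (Fin k) A}
    (hP : P ≠ 0) {S : Set ℝ} (hS : ¬ S.Countable)
    (h : ∀ t ∈ S, 0 < t ∧ Annihilates P truncGamma 1 (gammaPoint L t)) : HasRelation L := by
  refine ⟨MvPolynomial.rename Fin.val (MvPolynomial.map (algebraMap A ℝ) P), ?_,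
    eval_truncMoment_eq_zero hS fun t ht => ?_⟩
  · rw [Ne, map_eq_zero_iff _ (MvPolynomial.rename_injective _ Fin.val_injective),
      map_eq_zero_iff _ (MvPolynomial.map_injective _ hA)]
    exact hP
  · obtain ⟨h0, h1⟩ := h t ht
    rw [MvPolynomial.eval_rename, MvPolynomial.eval_map, ← h1, MvPolynomial.aeval_def]
    congr 1
    funext j
    simp only [Function.comp, partialDeriv_truncGamma (gammaPoint_mem_dom.2 h0)]
    simp [gammaPoint]

theorem LineClause.hasRelation {A : Type} [CommRing A] [Algebra A ℝ]
    (hA : Function.Injective (algebraMap A ℝ)) (h : LineClause A truncGamma 1) (L : ℝ) :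
    HasRelation L := by
  obtain ⟨k, P, J, hP, hJ, -, h1, h⟩ := h (gammaPoint L 1) (gammaPoint_mem_dom.2 one_pos)
  refine hasRelation_of_annihilates hA hP (not_countable_of_isOpen hJ ⟨_, h1⟩) fun t ht => ?_
  have := h t ht
  rwa [update_gammaPoint, gammaPoint_mem_dom] at this

theorem LocalClause.hasRelation {A : Type} [CommRing A] [Algebra A ℝ]
    (hA : Function.Injective (algebraMap A ℝ)) (h : LocalClause A truncGamma 1) (L : ℝ) :
    HasRelation L := by
  obtain ⟨k, P, J, hP, hJ, h1, hJD, h⟩ := h (gammaPoint L 1) (gammaPoint_mem_dom.2 one_pos)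
  exact hasRelation_of_annihilates hA hP
    (not_countable_of_isOpen (hJ.preimage (continuous_gammaPoint L)) ⟨1, h1⟩)
    fun t ht => ⟨gammaPoint_mem_dom.1 (hJD ht), h _ ht⟩

theorem GlobalClause.hasRelation {A : Type} [CommRing A] [Algebra A ℝ]
    (hA : Function.Injective (algebraMap A ℝ)) (h : GlobalClause A truncGamma 1) (L : ℝ) :
    HasRelation L := by
  have hconn : IsConnected truncGamma.Dom := by
    refine Convex.isConnected ?_ ⟨gammaPoint 0 1, gammaPoint_mem_dom.2 one_pos⟩
    have h0 : IsLinearMap ℝ fun p : Fin 2 → ℝ => p 0 := ⟨fun _ _ => rfl, fun _ _ => rfl⟩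
    have h1 : IsLinearMap ℝ fun p : Fin 2 → ℝ => p 1 := ⟨fun _ _ => rfl, fun _ _ => rfl⟩
    exact (convex_halfSpace_gt h0 0).inter (convex_halfSpace_gt h1 0)
  refine LocalClause.hasRelation hA (fun x hx => ?_) L
  obtain ⟨k, P, hP, h⟩ := h _ isOpen_dom_truncGamma hconn subset_rfl
  exact ⟨k, P, truncGamma.Dom, hP, isOpen_dom_truncGamma, hx, subset_rfl, h⟩

theorem countable_mvPolynomial_int (k : ℕ) : Countable (MvPolynomial (Fin k) ℤ) := by
  rw [← Cardinal.mk_le_aleph0_iff]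
  refine MvPolynomial.cardinalMk_le_max.trans ?_
  simp

/-- There are only countably many integer polynomials, so one of them works at uncountably many t;
the identity theorem does the rest. -/
theorem PointClause.hasRelation (h : PointClause ℤ truncGamma 1) (L : ℝ) : HasRelation L := by
  have := countable_mvPolynomial_int
  let S : (Σ k : ℕ, MvPolynomial (Fin k) ℤ) → Set ℝ := fun c =>
    {t | c.2 ≠ 0 ∧ 0 < t ∧ Annihilates c.2 truncGamma 1 (gammaPoint L t)}
  have hc : ∃ c, ¬ (S c).Countable := by
    by_contra! hc
    refine not_countable_of_isOpen (isOpen_Ioi (a := (0 : ℝ))) ⟨1, mem_Ioi.2 one_pos⟩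
      ((countable_iUnion hc).mono fun t ht => ?_)
    obtain ⟨k, P, hP, h⟩ := h (gammaPoint L t) (gammaPoint_mem_dom.2 ht)
    exact mem_iUnion.2 ⟨⟨k, P⟩, hP, ht, h⟩
  obtain ⟨c, hc⟩ := hc
  obtain ⟨t, ht⟩ : (S c).Nonempty := nonempty_iff_ne_empty.2 fun h => hc (h ▸ countable_empty)
  exact hasRelation_of_annihilates Int.cast_injective ht.1 hc fun t ht => ht.2

theorem not_forall_hasRelation : ¬ ∀ L, HasRelation L := by
  intro h
  choose Q hQ0 hQ using h
  let mon : (ℕ →₀ ℕ) → (ℕ → ℝ) → ℝ := fun s Y => ∏ i ∈ s.support, Y i ^ s i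
  -- There are countably many finite supports and uncountably many L.
  obtain ⟨F, hF⟩ : ∃ F : Finset (ℕ →₀ ℕ), ¬ {L | (Q L).support = F}.Countable := by
    by_contra! hc
    exact not_countable_of_isOpen isOpen_univ univ_nonempty
      ((countable_iUnion hc).mono fun L _ => mem_iUnion.2 ⟨(Q L).support, rfl⟩)
  have hdet0 : ∀ (x : F → ℝ) (L : ℝ),
      (Matrix.of fun i j : F => mon j fun n => truncMoment n L (x i)).det = 0 := by
    intro x
    refine eq_zero_of_analytic_of_not_countable (fun L => ?_) hF fun L hL => ?_
    · simp only [Matrix.det_apply, Matrix.of_apply]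
      refine Finset.analyticAt_fun_sum _ fun σ _ => ?_
      refine AnalyticAt.const_smul ?_
      exact Finset.analyticAt_fun_prod _ fun i _ => Finset.analyticAt_fun_prod _ fun j _ =>
        (analyticAt_truncMoment_left j L _).pow _
    -- For L with support F, the coefficient vector of `Q L` is a nonzero kernel vector.
    · rw [← Matrix.exists_mulVec_eq_zero_iff]
      refine ⟨fun s => (Q L).coeff s, fun h0 => hQ0 L ?_, funext fun i => ?_⟩
      · rw [← MvPolynomial.support_eq_empty, Finset.eq_empty_iff_forall_notMem]
        intro s hs
        have hsF : s ∈ F := by rwa [← (show (Q L).support = F from hL)]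
        exact MvPolynomial.mem_support_iff.1 hs (congrFun h0 ⟨s, hsF⟩)
      · have := hQ L (x i)
        rw [MvPolynomial.eval_eq, show (Q L).support = F from hL, ← Finset.sum_coe_sort] at this
        rw [Pi.zero_apply, ← this]
        exact Finset.sum_congr rfl fun s _ => mul_comm _ _
  have hdet : ∀ x : F → Ioi (0 : ℝ),
      (Matrix.of fun i j : F => mon j fun n => moment n (x i)).det = 0 := by
    intro x
    have ht : Tendsto (fun L => (Matrix.of fun i j : F =>
        mon j fun n => truncMoment n L (x i)).det) atTop
        (𝓝 (Matrix.of fun i j : F => mon j fun n => moment n (x i)).det) := by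
      simp only [Matrix.det_apply, Matrix.of_apply]
      refine tendsto_finsetSum _ fun σ _ => Tendsto.const_smul ?_ _
      exact tendsto_finsetProd _ fun i _ => tendsto_finsetProd _ fun j _ =>
        (tendsto_truncMoment j (x _).2).pow _
    exact tendsto_nhds_unique ht (by simp only [hdet0, tendsto_const_nhds])
  obtain ⟨c, hc0, hc⟩ := exists_ne_zero_forall_sum_eq_zero
    (fun (x : Ioi (0 : ℝ)) (s : F) => mon s fun n => moment n x) hdet
  -- The coefficients are real constants; independence over ℝ[x] is more than is needed here, but
  -- the shift argument requires it.
  let P : MvPolynomial ℕ (Polynomial ℝ) :=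
    ∑ s : F, MvPolynomial.monomial (s : ℕ →₀ ℕ) (Polynomial.C (c s))
  have hP : P = 0 := by
    refine eq_zero_of_eventually_evalAt_eq_zero moment_add_one
      (fun x hx => (moment_zero_pos x hx).ne') P ?_
    filter_upwards [eventually_gt_atTop 0] with x hx
    rw [← hc ⟨x, hx⟩, map_sum]
    refine Finset.sum_congr rfl fun s _ => ?_
    simp [evalAt, MvPolynomial.eval₂_monomial, mon, Finsupp.prod]
  refine hc0 (funext fun s => ?_)
  have := congrArg (MvPolynomial.coeff (s : ℕ →₀ ℕ)) hP
  simp only [P, MvPolynomial.coeff_sum, MvPolynomial.coeff_monomial, MvPolynomial.coeff_zero] at this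
  rw [Finset.sum_eq_single s (fun t _ ht => if_neg fun h => ht (Subtype.ext h)) (by simp),
    if_pos rfl] at this
  simpa using this

theorem not_differentiallyAlgebraic_truncGamma : ¬ DifferentiallyAlgebraic truncGamma := by
  rintro ⟨-, h⟩
  have hZ : Function.Injective (algebraMap ℤ ℝ) := Int.cast_injective
  have hR : Function.Injective (algebraMap ℝ ℝ) := Function.injective_id
  rcases h 1 with h | h | h | h | h | h | h
  · exact not_forall_hasRelation (h.hasRelation hZ)
  · exact not_forall_hasRelation (h.hasRelation hZ)
  · exact not_forall_hasRelation (h.hasRelation hZ)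
  · exact not_forall_hasRelation h.hasRelation
  · exact not_forall_hasRelation (h.hasRelation hR)
  · exact not_forall_hasRelation (h.hasRelation hR)
  · exact not_forall_hasRelation (h.hasRelation hR)

end NotDiffAlg

/-! ### Real primitive recursive functions -/

section PrimRec

/-- The scalar partial function with domain `D` that agrees with `F` there. -/
def onDom {m : ℕ} (D : Set (Fin m → ℝ)) (F : (Fin m → ℝ) → ℝ) : PVec m 1 :=
  fun x => ⟨x ∈ D, fun _ _ => F x⟩

/-- The restriction of `F` to `D` is real primitive recursive. -/
def RecOn {m : ℕ} (D : Set (Fin m → ℝ)) (F : (Fin m → ℝ) → ℝ) : Prop :=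
  RealPrimRec (onDom D F)

theorem onDom_congr {m : ℕ} {D D' : Set (Fin m → ℝ)} {F F' : (Fin m → ℝ) → ℝ} (hD : D = D')
    (hF : EqOn F F' D) : onDom D F = onDom D' F' := by
  subst hD
  funext x
  exact Part.ext' Iff.rfl fun h _ => funext fun _ => hF h

theorem RecOn.congr {m : ℕ} {D D' : Set (Fin m → ℝ)} {F F' : (Fin m → ℝ) → ℝ} (h : RecOn D F)
    (hD : D = D') (hF : EqOn F F' D) : RecOn D' F' := by
  rwa [RecOn, ← onDom_congr hD hF]

theorem RecOn.comp {m n : ℕ} {D₀ : Set (Fin n → ℝ)} {F : (Fin n → ℝ) → ℝ} (hF : RecOn D₀ F)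
    {D : Fin n → Set (Fin m → ℝ)} {G : Fin n → (Fin m → ℝ) → ℝ} (hG : ∀ i, RecOn (D i) (G i)) :
    RecOn {x | (∀ i, x ∈ D i) ∧ (fun i => G i x) ∈ D₀} fun x => F fun i => G i x := by
  have h := RealPrimRec.comp _ _ hF (RealPrimRec.juxt _ hG)
  have heq : onDom {x | (∀ i, x ∈ D i) ∧ (fun i => G i x) ∈ D₀} (fun x => F fun i => G i x) =
      PFun.comp (onDom D₀ F) (RealRec.juxt fun i => onDom (D i) (G i)) :=
    funext fun x => Part.ext' ⟨fun h => ⟨h.1, h.2⟩, fun h => ⟨h.1, h.2⟩⟩ fun _ _ => rfl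
  rwa [RecOn, heq]

theorem RecOn.comp_univ {m n : ℕ} {F : (Fin n → ℝ) → ℝ} (hF : RecOn univ F)
    {G : Fin n → (Fin m → ℝ) → ℝ} (hG : ∀ i, RecOn univ (G i)) :
    RecOn univ fun x => F fun i => G i x :=
  (hF.comp hG).congr (by simp) fun _ _ => rfl

theorem onDom_univ {m : ℕ} (F : (Fin m → ℝ) → ℝ) : onDom univ F = PFun.lift fun x _ => F x :=
  funext fun _ => Part.ext' (by simp [onDom]) fun _ _ => rfl

theorem recOn_zero (m : ℕ) : RecOn (m := m) univ fun _ => 0 :=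
  RecOn.comp_univ (n := 0) (F := fun _ => 0) (by rw [RecOn, onDom_univ]; exact .zero)
    (G := Fin.elim0) (fun i => i.elim0)

theorem recOn_one (m : ℕ) : RecOn (m := m) univ fun _ => 1 :=
  RecOn.comp_univ (n := 0) (F := fun _ => 1) (by rw [RecOn, onDom_univ]; exact .one)
    (G := Fin.elim0) (fun i => i.elim0)

theorem recOn_neg_one (m : ℕ) : RecOn (m := m) univ fun _ => -1 :=
  RecOn.comp_univ (n := 0) (F := fun _ => -1) (by rw [RecOn, onDom_univ]; exact .neg_one)
    (G := Fin.elim0) (fun i => i.elim0)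

/-! ### Differential recursion as solving a differential equation -/

theorem eq_of_hasDerivAt_eq {K H q : ℝ → ℝ} {t : ℝ} (h0 : K 0 = H 0)
    (hK : ∀ s ∈ uIcc 0 t, HasDerivAt K (q s) s) (hH : ∀ s ∈ uIcc 0 t, HasDerivAt H (q s) s) :
    K t = H t := by
  have h := intervalIntegral.integral_eq_sub_of_hasDerivAt (f := K - H) (f' := fun _ => 0)
    (fun s hs => ((hK s hs).sub (hH s hs)).congr_deriv (sub_self _)) (by simp)
  simp only [intervalIntegral.integral_zero, Pi.sub_apply, h0, sub_self, sub_zero] at h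
  linarith

theorem continuous_cat {m : ℕ} (v : Fin m → ℝ) :
    Continuous fun p : ℝ × (Fin 1 → ℝ) => cat v p.1 p.2 := by
  refine continuous_pi fun i => ?_
  refine Fin.addCases (fun i => ?_) (fun i => ?_) i
  · simp only [cat, Fin.append_left]
    refine Fin.lastCases ?_ (fun i => ?_) i
    · simpa using continuous_fst
    · simpa using continuous_const
  · simp only [cat, Fin.append_right]
    fun_prop

theorem total_onDom_univ {m : ℕ} (F : (Fin m → ℝ) → ℝ) (x : Fin m → ℝ) :
    total (onDom univ F) x = fun _ => F x :=
  total_of_mem ⟨mem_univ x, rfl⟩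

/-- A solution of the integral equation extends from `[0, t]` to a function on `ℝ` that solves the
differential equation on `[0, t]`. -/
theorem IsSolution.exists_hasDerivAt {m : ℕ} {F : (Fin m → ℝ) → ℝ} {G : (Fin (m + 1 + 1) → ℝ) → ℝ}
    (hG : Continuous G) {v : Fin m → ℝ} {h : ℝ →. (Fin 1 → ℝ)}
    (hh : IsSolution (onDom univ F) (onDom univ G) v h) {t : ℝ} (ht : t ∈ h.Dom) :
    ∃ K : ℝ → ℝ, K 0 = F v ∧ (total h t = fun _ => K t) ∧
      ∀ s ∈ uIcc 0 t, HasDerivAt K (G (cat v s fun _ => K s)) s := by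
  have hsub : uIcc 0 t ⊆ h.Dom :=
    hh.ordConnected.uIcc_subset (hh.zero_mem ⟨t, ht⟩) ht
  set w : ℝ → ℝ := fun τ => G (cat v τ (total h τ)) with hw
  have hwv : (fun τ => total (onDom univ G) (cat v τ (total h τ))) = fun τ _ => w τ :=
    funext fun τ => total_onDom_univ _ _
  have heqn : ∀ s ∈ uIcc 0 t, total h s =
      (fun _ => F v) + ∫ τ in (0 : ℝ)..s, fun _ : Fin 1 => w τ := by
    intro s hs
    have := hh.eqn s (hsub hs)
    rwa [total_onDom_univ, hwv] at this
  have hint : IntervalIntegrable (fun τ (_ : Fin 1) => w τ) volume 0 t := by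
    have := hh.integrable t ht
    rwa [hwv] at this
  -- Being a primitive, h is continuous, and hence so is its integrand.
  have hcont : ContinuousOn (total h) (uIcc 0 t) :=
    (continuousOn_const.add
      (intervalIntegral.continuousOn_primitive_interval' hint left_mem_uIcc)).congr heqn
  have hwc : ContinuousOn w (uIcc 0 t) :=
    (hG.comp (continuous_cat v)).comp_continuousOn (continuousOn_id.prodMk hcont)
  -- The constant extension beyond the endpoints makes the primitive two-sidedly differentiable at 0
  -- and t.
  set W : ℝ → ℝ := IccExtend (inf_le_sup (a := (0 : ℝ)) (b := t)) ((uIcc 0 t).domRestrict w) with hW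
  have hWc : Continuous W := (continuousOn_iff_continuous_domRestrict.1 hwc).Icc_extend'
  have hWw : EqOn W w (uIcc 0 t) := fun s hs => IccExtend_of_mem _ _ hs
  have hK : ∀ s ∈ uIcc 0 t, total h s = fun _ => F v + ∫ τ in (0 : ℝ)..s, W τ := by
    intro s hs
    have hss : uIcc 0 s ⊆ uIcc 0 t := uIcc_subset_uIcc left_mem_uIcc hs
    rw [heqn s hs]
    funext i
    have h1 := (ContinuousLinearMap.proj (R := ℝ) (φ := fun _ : Fin 1 => ℝ)
      i).intervalIntegral_comp_comm (hint.mono_set hss)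
    rw [Pi.add_apply, intervalIntegral.integral_congr (hWw.mono hss)]
    congr 1
    exact h1.symm
  refine ⟨fun s => F v + ∫ τ in (0 : ℝ)..s, W τ, by simp, hK t right_mem_uIcc, fun s hs => ?_⟩
  have hd := (hWc.integral_hasStrictDerivAt 0 s).hasDerivAt.const_add (F v)
  refine hd.congr_deriv ?_
  rw [hWw hs, hw, ← hK s hs]

/-- H on I is a solution, and `huniq` says every solution restricts it. So it is unique and also
maximal: the operator returns exactly the domain I. -/
theorem diffRec_onDom {m : ℕ} {F : (Fin m → ℝ) → ℝ} {G : (Fin (m + 1 + 1) → ℝ) → ℝ}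
    (hG : Continuous G) {I : Set ℝ} (hI : I.OrdConnected) (h0 : 0 ∈ I)
    {H : (Fin m → ℝ) → ℝ → ℝ} (hH0 : ∀ v, H v 0 = F v)
    (hH : ∀ v, ∀ t ∈ I, HasDerivAt (H v) (G (cat v t fun _ => H v t)) t)
    (huniq : ∀ v (K : ℝ → ℝ) t, K 0 = F v →
      (∀ s ∈ uIcc 0 t, HasDerivAt K (G (cat v s fun _ => K s)) s) → t ∈ I ∧ K t = H v t) :
    diffRec (onDom univ F) (onDom univ G) =
      onDom {p | p (Fin.last m) ∈ I} fun p => H (Fin.init p) (p (Fin.last m)) := by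
  have hsol : ∀ v, ∀ k, IsSolution (onDom univ F) (onDom univ G) v k → ∀ t, ∀ y ∈ k t,
      t ∈ I ∧ y = fun _ => H v t := by
    intro v k hk t y hy
    obtain ⟨K, hK0, hKt, hK⟩ := hk.exists_hasDerivAt hG ((PFun.mem_dom k t).2 ⟨y, hy⟩)
    obtain ⟨h1, h2⟩ := huniq v K t hK0 hK
    exact ⟨h1, by rw [← total_of_mem hy, hKt, h2]⟩
  have hun : ∀ v, IsUniqueIn {k | IsSolution (onDom univ F) (onDom univ G) v k}
      fun t => ⟨t ∈ I, fun _ _ => H v t⟩ := by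
    intro v
    set h : ℝ →. (Fin 1 → ℝ) := fun t => ⟨t ∈ I, fun _ _ => H v t⟩ with hh
    have htot : ∀ t ∈ I, total h t = fun _ => H v t := fun t ht => total_of_mem ⟨ht, rfl⟩
    have hsub : ∀ t ∈ I, uIcc 0 t ⊆ I := fun t ht => hI.uIcc_subset h0 ht
    have hval : ∀ t ∈ I, total (onDom univ G) (cat v t (total h t)) =
        fun _ => G (cat v t fun _ => H v t) := fun t ht => by
      rw [total_onDom_univ, htot t ht]
    have hc : ContinuousOn (fun t (_ : Fin 1) => G (cat v t fun _ => H v t)) I := by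
      have h1 : ContinuousOn (H v) I := fun t ht => (hH v t ht).continuousAt.continuousWithinAt
      have h2 : ContinuousOn (fun t => (t, fun _ : Fin 1 => H v t)) I :=
        continuousOn_id.prodMk (continuousOn_pi.2 fun _ => h1)
      exact continuousOn_pi.2 fun _ =>
        (hG.comp (continuous_cat v)).comp_continuousOn h2
    refine ⟨⟨hI, fun _ => h0, fun _ => mem_univ v, fun _ _ _ => mem_univ _, fun t ht => ?_,
      fun t ht => ?_⟩, fun k hk t _ y hy => ?_⟩
    · exact ((hc.mono (hsub t ht)).congr fun s hs => hval s (hsub t ht hs)).intervalIntegrable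
    · have hFTC := intervalIntegral.integral_eq_sub_of_hasDerivAt
        (f := fun t (_ : Fin 1) => H v t) (a := 0) (b := t)
        (fun s hs => hasDerivAt_pi.2 fun _ => hH v s (hsub t ht hs))
        (hc.mono (hsub t ht)).intervalIntegrable
      rw [intervalIntegral.integral_congr fun s hs => hval s (hsub t ht hs), hFTC, htot t ht,
        total_onDom_univ, hH0]
      funext _
      simp
    · obtain ⟨h1, rfl⟩ := hsol v k hk t y hy
      exact ⟨h1, rfl⟩
  funext p
  refine Part.ext fun y => ⟨fun hy => ?_, ?_⟩
  · obtain ⟨h1, h2⟩ := hsol _ _ (isUniqueIn_maxUnique _ _ (Fin.init p)).1 _ y hy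
    exact ⟨h1, h2.symm⟩
  · rintro ⟨h1, rfl⟩
    exact mem_maxUnique (hun _) ⟨h1, rfl⟩

theorem RecOn.diffRec {m : ℕ} {F : (Fin m → ℝ) → ℝ} {G : (Fin (m + 1 + 1) → ℝ) → ℝ}
    (rF : RecOn univ F) (rG : RecOn univ G)
    (hG : Continuous G) {I : Set ℝ} (hI : I.OrdConnected) (h0 : 0 ∈ I)
    {H : (Fin m → ℝ) → ℝ → ℝ} (hH0 : ∀ v, H v 0 = F v)
    (hH : ∀ v, ∀ t ∈ I, HasDerivAt (H v) (G (cat v t fun _ => H v t)) t)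
    (huniq : ∀ v (K : ℝ → ℝ) t, K 0 = F v →
      (∀ s ∈ uIcc 0 t, HasDerivAt K (G (cat v s fun _ => K s)) s) → t ∈ I ∧ K t = H v t) :
    RecOn {p | p (Fin.last m) ∈ I} fun p => H (Fin.init p) (p (Fin.last m)) := by
  rw [RecOn, ← diffRec_onDom hG hI h0 hH0 hH huniq]
  exact .diffRec _ _ rF rG

/-- Parametric antiderivatives of real primitive recursive functions are real primitive
recursive. -/
theorem RecOn.antideriv {m : ℕ} {F : (Fin m → ℝ) → ℝ} {G : (Fin (m + 1 + 1) → ℝ) → ℝ}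
    (rF : RecOn univ F) (rG : RecOn univ G) (hG : Continuous G) {H q : (Fin m → ℝ) → ℝ → ℝ}
    (hH0 : ∀ v, H v 0 = F v) (hq : ∀ v t y, G (cat v t y) = q v t)
    (hH : ∀ v t, HasDerivAt (H v) (q v t) t) :
    RecOn univ fun p => H (Fin.init p) (p (Fin.last m)) := by
  refine (rF.diffRec rG hG ordConnected_univ (mem_univ 0) hH0 (fun v t _ => ?_)
    fun v K t hK0 hK => ⟨mem_univ t, ?_⟩).congr (by simp) fun _ _ => rfl
  · rw [hq]
    exact hH v t
  · simp only [hq] at hK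
    exact eq_of_hasDerivAt_eq (hK0.trans (hH0 v).symm) hK fun s _ => hH v s

/-! ### Projections, arithmetic, exponential and logarithm -/

theorem recOn_proj : ∀ {m : ℕ} (i : Fin m), RecOn univ fun x => x i
  | 0, i => i.elim0
  | m + 1, i => by
    refine Fin.lastCases ?_ (fun i => ?_) i
    · exact (recOn_zero m).antideriv (recOn_one _) continuous_const (H := fun _ t => t)
        (q := fun _ _ => 1) (fun _ => rfl) (fun _ _ _ => rfl) fun _ t => hasDerivAt_id t
    · exact (recOn_proj i).antideriv (recOn_zero _) continuous_const (H := fun v _ => v i)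
        (q := fun _ _ => 0) (fun _ => rfl) (fun _ _ _ => rfl) fun v t => hasDerivAt_const t _

theorem RecOn.comp₁ {m : ℕ} {D₀ : Set (Fin 1 → ℝ)} {F : (Fin 1 → ℝ) → ℝ} (hF : RecOn D₀ F)
    {D : Set (Fin m → ℝ)} {G : (Fin m → ℝ) → ℝ} (hG : RecOn D G) :
    RecOn {x | x ∈ D ∧ (fun _ => G x) ∈ D₀} fun x => F fun _ => G x :=
  (hF.comp (D := fun _ => D) (G := fun _ => G) fun _ => hG).congr (by simp) fun _ _ => rfl

theorem RecOn.comp₂ {m : ℕ} {F : (Fin 2 → ℝ) → ℝ} (hF : RecOn univ F)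
    {D₁ D₂ : Set (Fin m → ℝ)} {G₁ G₂ : (Fin m → ℝ) → ℝ} (h₁ : RecOn D₁ G₁) (h₂ : RecOn D₂ G₂) :
    RecOn (D₁ ∩ D₂) fun x => F ![G₁ x, G₂ x] := by
  refine (hF.comp (D := ![D₁, D₂]) (G := ![G₁, G₂])
    (Fin.forall_fin_two.2 ⟨h₁, h₂⟩)).congr ?_ fun x _ => ?_
  · ext x
    simp [Fin.forall_fin_two]
  · change F _ = F _
    congr 1
    funext i
    fin_cases i <;> rfl

theorem RecOn.add {m : ℕ} {D₁ D₂ : Set (Fin m → ℝ)} {G₁ G₂ : (Fin m → ℝ) → ℝ}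
    (h₁ : RecOn D₁ G₁) (h₂ : RecOn D₂ G₂) : RecOn (D₁ ∩ D₂) fun x => G₁ x + G₂ x :=
  RecOn.comp₂ (F := fun p => p 0 + p 1)
    ((recOn_proj (0 : Fin 1)).antideriv (recOn_one _) continuous_const
      (H := fun v t => v 0 + t) (q := fun _ _ => 1) (by simp) (fun _ _ _ => rfl)
      fun v t => (hasDerivAt_id t).const_add _) h₁ h₂

theorem RecOn.mul {m : ℕ} {D₁ D₂ : Set (Fin m → ℝ)} {G₁ G₂ : (Fin m → ℝ) → ℝ}
    (h₁ : RecOn D₁ G₁) (h₂ : RecOn D₂ G₂) : RecOn (D₁ ∩ D₂) fun x => G₁ x * G₂ x :=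
  RecOn.comp₂ (F := fun p => p 0 * p 1)
    ((recOn_zero 1).antideriv (recOn_proj (0 : Fin 3)) (continuous_apply 0)
      (H := fun v t => v 0 * t) (q := fun v _ => v 0) (by simp) (fun _ _ _ => rfl)
      fun v t => by simpa using (hasDerivAt_id t).const_mul (v 0)) h₁ h₂

theorem RecOn.neg {m : ℕ} {D : Set (Fin m → ℝ)} {G : (Fin m → ℝ) → ℝ} (h : RecOn D G) :
    RecOn D fun x => -G x :=
  ((recOn_neg_one m).mul h).congr (univ_inter D) fun _ _ => neg_one_mul _

theorem recOn_exp : RecOn (m := 1) univ fun x => Real.exp (x 0) := by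
  refine ((recOn_one 0).diffRec (recOn_proj (1 : Fin 2)) (continuous_apply 1) ordConnected_univ
    (mem_univ 0) (H := fun _ => Real.exp) (by simp) (fun _ t _ => Real.hasDerivAt_exp t)
    fun v K t hK0 hK => ⟨mem_univ t, ?_⟩).congr (by simp) fun _ _ => rfl
  -- For any solution K of y' = y with K 0 = 1, the product e^(-s)K(s) is constant.
  have h := eq_of_hasDerivAt_eq (K := fun s => Real.exp (-s) * K s) (H := fun _ => 1)
    (q := fun _ => 0) (t := t) (by simp [hK0])
    (fun s hs => ((hasDerivAt_neg s).exp.mul (hK s hs)).congr_deriv ?_)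
    fun s _ => hasDerivAt_const s _
  · simp only [Real.exp_neg] at h
    field_simp at h
    exact h
  · change Real.exp (-s) * -1 * K s + Real.exp (-s) * K s = 0
    ring

theorem RecOn.exp {m : ℕ} {D : Set (Fin m → ℝ)} {G : (Fin m → ℝ) → ℝ} (h : RecOn D G) :
    RecOn D fun x => Real.exp (G x) :=
  (recOn_exp.comp₁ h).congr (by simp) fun _ _ => rfl

/-- Any solution K of y' = e^(-y), y(0) = 0 satisfies e^K = 1 + t. This determines K and also
confines t to (-1, ∞), so the partial domain is produced by the recursion itself. -/
theorem recOn_log_one_add : RecOn (m := 1) {x | -1 < x 0} fun x => Real.log (1 + x 0) := by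
  refine (recOn_zero 0).diffRec (recOn_proj (1 : Fin 2)).neg.exp (by fun_prop)
    (I := Ioi (-1)) ordConnected_Ioi (by simp) (H := fun _ t => Real.log (1 + t)) (by simp)
    (fun _ t ht => ?_) fun v K t hK0 hK => ?_
  · have ht' : 0 < 1 + t := by
      have := mem_Ioi.1 ht
      linarith
    refine (((hasDerivAt_id t).const_add 1).log ht'.ne').congr_deriv ?_
    change 1 / (1 + t) = Real.exp (-Real.log (1 + t))
    rw [Real.exp_neg, Real.exp_log ht', one_div]
  · have h := eq_of_hasDerivAt_eq (K := fun s => Real.exp (K s)) (H := fun s => 1 + s)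
      (q := fun _ => 1) (t := t) (by simp [hK0])
      (fun s hs => (hK s hs).exp.congr_deriv ?_) fun s _ => (hasDerivAt_id s).const_add 1
    · have h' : Real.exp (K t) = 1 + t := h
      refine ⟨?_, by rw [← h', Real.log_exp]⟩
      have := Real.exp_pos (K t)
      rw [mem_Ioi]
      linarith
    · change Real.exp (K s) * Real.exp (-K s) = 1
      rw [← Real.exp_add]
      simp

theorem RecOn.log {m : ℕ} {D : Set (Fin m → ℝ)} {G : (Fin m → ℝ) → ℝ} (h : RecOn D G) :
    RecOn {x | x ∈ D ∧ 0 < G x} fun x => Real.log (G x) := by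
  refine (recOn_log_one_add.comp₁ (h.add (recOn_neg_one m))).congr ?_ fun x _ => ?_
  · ext x
    simp
  · change Real.log (1 + (G x + -1)) = _
    congr 1
    ring

theorem recOn_integral_exp :
    RecOn (m := 2) univ fun p => ∫ s in (0 : ℝ)..p 1, Real.exp (p 0 * s - Real.exp s) := by
  have hG : RecOn (m := 3) univ fun p => Real.exp (p 0 * p 1 + -Real.exp (p 1)) :=
    ((((recOn_proj 0).mul (recOn_proj 1)).add (recOn_proj 1).exp.neg).exp).congr (by simp)
      fun _ _ => rfl
  refine (recOn_zero 1).antideriv hG (by fun_prop)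
    (H := fun v t => ∫ s in (0 : ℝ)..t, Real.exp (v 0 * s - Real.exp s))
    (q := fun v t => Real.exp (v 0 * t - Real.exp t)) (by simp) (fun _ _ _ => ?_) fun v t => ?_
  · rw [sub_eq_add_neg]
    rfl
  · exact (Continuous.integral_hasStrictDerivAt (by fun_prop) 0 t).hasDerivAt

theorem realPrimRec_truncGamma : RealPrimRec truncGamma := by
  have hL := (recOn_proj (0 : Fin 2)).log
  have hx := recOn_proj (1 : Fin 2)
  -- The integral over [-L, L] is a difference of integrals from 0. The summand 0 · ln x only cuts
  -- the domain down to x > 0.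
  have h := ((recOn_integral_exp.comp₂ hx hL).add (recOn_integral_exp.comp₂ hx hL.neg).neg).add
    ((recOn_zero 2).mul hx.log)
  refine h.congr (D' := {p | 0 < p 0 ∧ 0 < p 1}) (F' := fun p =>
    ∫ t in (1 / p 0)..(p 0), Real.exp ((p 1 - 1) * Real.log t - t)) ?_ fun p hp => ?_
  · ext p
    simp
  · have hp0 : 0 < p 0 := hp.1.1.2.2
    have hi : ∀ a b : ℝ, IntervalIntegrable (fun s => Real.exp (p 1 * s - Real.exp s)) volume a b :=
      fun a b => Continuous.intervalIntegrable (by fun_prop) a b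
    simp only [Matrix.cons_val_zero, Matrix.cons_val_one]
    rw [integral_exp_log_eq_truncMoment hp0, truncMoment]
    simp only [pow_zero, one_mul, zero_mul, add_zero]
    rw [← sub_eq_add_neg, intervalIntegral.integral_interval_sub_left (hi _ _) (hi _ _)]

end PrimRec

end

end RealRec

theorem mainTheorem1 :
    RealRec.RealPrimRec RealRec.truncGamma ∧
    RealRec.IsAnalytic RealRec.truncGamma ∧
    ¬ RealRec.DifferentiallyAlgebraic RealRec.truncGamma ∧
    ¬ (∀ (m : ℕ) (f : RealRec.PVec m 1),
        RealRec.RealPrimRec f → RealRec.DifferentiallyAlgebraic f) :=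
  ⟨RealRec.realPrimRec_truncGamma, RealRec.isAnalytic_truncGamma,
    RealRec.not_differentiallyAlgebraic_truncGamma, fun h =>
      RealRec.not_differentiallyAlgebraic_truncGamma (h 2 _ RealRec.realPrimRec_truncGamma)⟩
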